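/- Let $\mathbb K$ be $\mathbb R$ or $\mathbb C$, let $q>0$ be real, and let $n\ge 2$, $N\ge 0$ and $k\ge 0$ be integers with $2k\le N$. Write $[m]_q=\frac{q^m-q^{-m}}{q-q^{-1}}$ (with $[m]_1=m$). Let $(\mathbb K^n)^{\otimes N}$ carry the standard inner product, let $x_1,\dots,x_n$ be the standard basis of $\mathbb K^n$ and $e_{ab}$ the matrix units. Put $$r=\sum_{a}e_{aa}\otimes e_{aa}+q^{-1}\sum_{a\ne b}e_{ab}\otimes e_{ba}+(1-q^{-2})\sum_{a>b}e_{aa}\otimes e_{bb},\qquad \mathcal H=\sum_{j=1}^{N-1}r_j,$$ where $r_j$ is $r$ acting on the tensor factors $j,j+1$. With $s_1=e_{11}-e_{22}$ let $$E_1=\sum_{j=1}^N (q^{-s_1/2})^{\otimes (j-1)}\otimes e_{21}\otimes (q^{s_1/2})^{\otimes (N-j)},\qquad F_1=\sum_{j=1}^N (q^{-s_1/2})^{\otimes (j-1)}\otimes e_{12}\otimes (q^{s_1/2})^{\otimes (N-j)},\qquad q^{H_1}=(q^{s_1})^{\otimes N}.$$ For $q\neq1$ these are the actions of $e_1,f_1,q^{h_1}\in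 U_q(\mathfrak{gl}_2)\subseteq U_q(\mathfrak{gl}_n)$ on $(\mathbb K^n)^{\otimes N}$, and $q^{\pm\varepsilon_i/2}$ ($i=1,2$) acts as $(q^{\pm e_{ii}/2})^{\otimes N}$. For $0\le m\le N$ let $W_m$ be the span of the words $x_{w_1}\otimes\cdots\otimes x_{w_N}$ with $w_i\in\{1,2\}$ in which $x_2$ occurs exactly $m$ times. Assume that the eigenvalue problem $\mathcal H b=\Lambda b$, $0\neq b\in W_k$, has distinct eigenvalues, i.e. has $\binom Nk=\dim W_k$ different eigenvalues $\Lambda\in\mathbb R$. Then: (1) Exactly $m_k=\binom Nk-\binom N{k-1}=\frac{N!}{k!\,(N-k+1)!}(N-2k+1)$ of these eigenvalues (with $\binom N{-1}=0$) have an eigenvector $0\ne b\in W_k$ with $F_1b=0$, and for these eigenvalues every eigenvector $b\in W_k$ satisfies $F_1b=0$. Let now $0\ne b\in W_k$ be any vector with $\mathcal Hb=\Lambda b$, $\Lambda\in\mathbb R$, and $F_1b=0$, and put $b_{(N-m)m}=E_1^{m-k}b$ for $m\ge k$. (2) $F_1b_{(N-m-1)(m+1)}=[N-k-m]_q\,[m-k+1]_q\,b_{(N-m)m}$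 for $k\le m\le N-k-1$; $E_1b_{k(N-k)}=0$; and $q^{H_1}b_{(N-m)m}=q^{N-2m}\,b_{(N-m)m}$ for $k\le m\le N-k$. (3) For $k\le m\le N-k$ the vector $b_{(N-m)m}$ is non-zero, lies in $W_m$ and satisfies $\mathcal Hb_{(N-m)m}=\Lambda b_{(N-m)m}$. The vectors $b_{(N-m)m}$, $k\le m\le N-k$, are pairwise orthogonal and form a basis of an $(N-2k+1)$-dimensional subspace $V$, which is invariant under $E_1$ and $F_1$ and has no invariant subspaces under them other than $0$ and $V$. If $q\ne1$, then $V$ is an irreducible $U_q(\mathfrak{gl}_2)$-module under the above action, and the vectors $\beta_i=b_{(N-k-i)(k+i)}$, $0\le i\le d-1$, $d=N-2k+1$, are a canonical basis of it: $f_1\beta_0=0$, $e_1\beta_{d-1}=0$, $e_1\beta_i=\beta_{i+1}$ and $f_1\beta_{i+1}=[i+1]_q[d-1-i]_q\,\beta_i$ for $0\le i\le d-2$, and $q^{h_1}\beta_i=q^{d-1-2i}\beta_i$ for $0\le i\le d-1$. -/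

import Mathlib

open scoped Kronecker

noncomputable section

namespace SpinChain

/-- The `q`-number `[m]_q = (q^m - q^(-m)) / (q - q^(-1))`, with its limiting value `m` at the
isotropic point `q = 1`. -/
def qInt (q : ℝ) (m : ℕ) : ℝ :=
  if q = 1 then (m : ℝ) else (q ^ m - (q ^ m)⁻¹) / (q - q⁻¹)

/-- The space `(𝕜^n)^{⊗N}`: a vector is given by its coordinates in the orthonormal basis of the
words `x_{w_1} ⊗ ⋯ ⊗ x_{w_N}`, `w : Fin N → Fin n`, and the inner product is the standard one. -/
abbrev TensorSpace (𝕜 : Type*) (n N : ℕ) : Type _ := EuclideanSpace 𝕜 (Fin N → Fin n)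

/-- The basis vector `x_{w_1} ⊗ ⋯ ⊗ x_{w_N}`. -/
def wordVec (𝕜 : Type*) [RCLike 𝕜] {n N : ℕ} (w : Fin N → Fin n) : TensorSpace 𝕜 n N :=
  EuclideanSpace.single w (1 : 𝕜)

/-- The letter `x_1`. -/
def x₁ {n : ℕ} (hn : 2 ≤ n) : Fin n := ⟨0, by omega⟩

/-- The letter `x_2`. -/
def x₂ {n : ℕ} (hn : 2 ≤ n) : Fin n := ⟨1, by omega⟩

/-- The word with `x_2` at the positions in `S` and `x_1` at all the other positions. -/
def wordOf {n N : ℕ} (hn : 2 ≤ n) (S : Finset (Fin N)) : Fin N → Fin n :=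
  fun i => if i ∈ S then x₂ hn else x₁ hn

/-- The states `𝔟_{(N-k)k}`: all linear combinations
`∑_{i_1 < ⋯ < i_k} a_{i_1 … i_k} x_1 ⋯ x_2 ⋯ x_2 ⋯ x_1` of words in `x_1, x_2` that have `x_2` at
exactly `k` positions `i_1, …, i_k`. -/
def stateSpace (𝕜 : Type*) [RCLike 𝕜] {n : ℕ} (hn : 2 ≤ n) (N k : ℕ) :
    Submodule 𝕜 (TensorSpace 𝕜 n N) :=
  Submodule.span 𝕜 {v | ∃ S : Finset (Fin N), S.card = k ∧ v = wordVec 𝕜 (wordOf hn S)}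

/-! ### The Hamiltonian -/

/-- The braid operator
`r = ∑_a e_{aa} ⊗ e_{aa} + q^(-1) ∑_{a ≠ b} e_{ab} ⊗ e_{ba}
      + (1 - q^(-2)) ∑_{a > b} e_{aa} ⊗ e_{bb}`. -/
def rMatrix (𝕜 : Type*) [RCLike 𝕜] (n : ℕ) (q : ℝ) : Matrix (Fin n × Fin n) (Fin n × Fin n) 𝕜 :=
  (∑ a : Fin n, Matrix.single a a (1 : 𝕜) ⊗ₖ Matrix.single a a (1 : 𝕜))
  + ((q⁻¹ : ℝ) : 𝕜) • (∑ a : Fin n, ∑ b : Fin n,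
      if a ≠ b then Matrix.single a b (1 : 𝕜) ⊗ₖ Matrix.single b a (1 : 𝕜) else 0)
  + ((1 - (q ^ 2)⁻¹ : ℝ) : 𝕜) • (∑ a : Fin n, ∑ b : Fin n,
      if b < a then Matrix.single a a (1 : 𝕜) ⊗ₖ Matrix.single b b (1 : 𝕜) else 0)

/-- The matrix of `1 ⊗ ⋯ ⊗ M ⊗ ⋯ ⊗ 1` with `M` acting on the tensor factors `i` and `j`. -/
def twoSite {𝕜 : Type*} [RCLike 𝕜] {n N : ℕ} (M : Matrix (Fin n × Fin n) (Fin n × Fin n) 𝕜)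
    (i j : Fin N) : Matrix (Fin N → Fin n) (Fin N → Fin n) 𝕜 :=
  fun w w' => if ∀ l, l ≠ i → l ≠ j → w l = w' l then M (w i, w j) (w' i, w' j) else 0

/-- The Hamiltonian `𝓗 = ∑_{j=1}^{N-1} r_j`, where `r_j` is `r` acting on the factors
`j, j+1`. -/
def hamiltonian (𝕜 : Type*) [RCLike 𝕜] (n N : ℕ) (q : ℝ) : Module.End 𝕜 (TensorSpace 𝕜 n N) :=
  Matrix.toEuclideanLin (∑ j : Fin (N - 1),
    twoSite (rMatrix 𝕜 n q) (⟨j.1, by omega⟩ : Fin N) (⟨j.1 + 1, by omega⟩ : Fin N))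

/-! ### The operators `E_1, F_1, q^{H_1}, q^{𝓔_i}` -/

/-- The operator `A_1 ⊗ A_2 ⊗ ⋯ ⊗ A_N` for `n × n` matrices `A_1, …, A_N`. -/
def tensorOp {𝕜 : Type*} [RCLike 𝕜] {n N : ℕ} (A : Fin N → Matrix (Fin n) (Fin n) 𝕜) :
    Module.End 𝕜 (TensorSpace 𝕜 n N) :=
  Matrix.toEuclideanLin (fun w w' => ∏ l, A l (w l) (w' l))

/-- `q^D` for the diagonal matrix `D = diag(c_1, …, c_n)`. -/
def qDiag (𝕜 : Type*) [RCLike 𝕜] {n : ℕ} (q : ℝ) (c : Fin n → ℝ) : Matrix (Fin n) (Fin n) 𝕜 :=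
  Matrix.diagonal fun a => ((q ^ c a : ℝ) : 𝕜)

/-- The diagonal of `s_1 = e_{11} - e_{22}`. -/
def sDiag {n : ℕ} (hn : 2 ≤ n) : Fin n → ℝ := Pi.single (x₁ hn) 1 - Pi.single (x₂ hn) 1

/-- `∑_j q^(-s_1/2) ⊗ ⋯ ⊗ q^(-s_1/2) ⊗ X ⊗ q^(s_1/2) ⊗ ⋯ ⊗ q^(s_1/2)`, with `X` at the position
`j`: the `N`-fold coproduct of a Chevalley generator that the fundamental representation sends
to `X`. -/
def coproductOp {𝕜 : Type*} [RCLike 𝕜] {n : ℕ} (hn : 2 ≤ n) (N : ℕ) (q : ℝ)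
    (X : Matrix (Fin n) (Fin n) 𝕜) : Module.End 𝕜 (TensorSpace 𝕜 n N) :=
  ∑ j : Fin N, tensorOp fun l =>
    if l < j then qDiag 𝕜 q (fun a => -(sDiag hn a) / 2)
    else if l = j then X
    else qDiag 𝕜 q (fun a => sDiag hn a / 2)

/-- `E_1`, the action of `e_1`, which the fundamental representation sends to `e_{21}`. -/
def E₁ (𝕜 : Type*) [RCLike 𝕜] {n : ℕ} (hn : 2 ≤ n) (N : ℕ) (q : ℝ) :
    Module.End 𝕜 (TensorSpace 𝕜 n N) :=
  coproductOp hn N q (Matrix.single (x₂ hn) (x₁ hn) 1)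

/-- `F_1`, the action of `f_1`, which the fundamental representation sends to `e_{12}`. -/
def F₁ (𝕜 : Type*) [RCLike 𝕜] {n : ℕ} (hn : 2 ≤ n) (N : ℕ) (q : ℝ) :
    Module.End 𝕜 (TensorSpace 𝕜 n N) :=
  coproductOp hn N q (Matrix.single (x₁ hn) (x₂ hn) 1)

/-- `q^{H_1} = q^{s_1} ⊗ ⋯ ⊗ q^{s_1}`. -/
def qH₁ (𝕜 : Type*) [RCLike 𝕜] {n : ℕ} (hn : 2 ≤ n) (N : ℕ) (q : ℝ) :
    Module.End 𝕜 (TensorSpace 𝕜 n N) :=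
  tensorOp fun _ => qDiag 𝕜 q (sDiag hn)

/-- `q^{t 𝓔_a} = q^{t e_{aa}} ⊗ ⋯ ⊗ q^{t e_{aa}}` for a letter `a` and a real number `t`. -/
def qEps (𝕜 : Type*) [RCLike 𝕜] {n : ℕ} (N : ℕ) (q t : ℝ) (a : Fin n) :
    Module.End 𝕜 (TensorSpace 𝕜 n N) :=
  tensorOp fun _ => qDiag 𝕜 q (Pi.single a t)

/-! ### The quantum algebra `U_q(gl_2)` -/

/-- Generators of `U_q(gl_2)`: `e`, `f`, and `q^{ε_i/2}`, `q^{-ε_i/2}` for `i = 1, 2`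
(the index `i` runs through `Fin 2 = {0, 1}`). -/
inductive UqGen : Type
  | e : UqGen
  | f : UqGen
  | kPos (i : Fin 2) : UqGen
  | kNeg (i : Fin 2) : UqGen

/-- `q^{h/2} = q^{ε_1/2} q^{-ε_2/2}` in the free algebra. -/
def freeQHalfH (𝕜 : Type*) [RCLike 𝕜] : FreeAlgebra 𝕜 UqGen :=
  FreeAlgebra.ι 𝕜 (UqGen.kPos 0) * FreeAlgebra.ι 𝕜 (UqGen.kNeg 1)

/-- `q^{-h/2} = q^{-ε_1/2} q^{ε_2/2}` in the free algebra. -/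
def freeQHalfHInv (𝕜 : Type*) [RCLike 𝕜] : FreeAlgebra 𝕜 UqGen :=
  FreeAlgebra.ι 𝕜 (UqGen.kNeg 0) * FreeAlgebra.ι 𝕜 (UqGen.kPos 1)

/-- The defining relations of `U_q(gl_2)` (for `q ≠ 1`). They imply
`q^{h/2} f = q f q^{h/2}` and `q^{h/2} e = q^{-1} e q^{h/2}`, and that `q^{ε_1 + ε_2}` is
central. -/
inductive UqRel (𝕜 : Type*) [RCLike 𝕜] (q : ℝ) :
    FreeAlgebra 𝕜 UqGen → FreeAlgebra 𝕜 UqGen → Prop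
  | pos_neg (i : Fin 2) :
      UqRel 𝕜 q (FreeAlgebra.ι 𝕜 (UqGen.kPos i) * FreeAlgebra.ι 𝕜 (UqGen.kNeg i)) 1
  | neg_pos (i : Fin 2) :
      UqRel 𝕜 q (FreeAlgebra.ι 𝕜 (UqGen.kNeg i) * FreeAlgebra.ι 𝕜 (UqGen.kPos i)) 1
  | comm :
      UqRel 𝕜 q (FreeAlgebra.ι 𝕜 (UqGen.kPos 0) * FreeAlgebra.ι 𝕜 (UqGen.kPos 1))
        (FreeAlgebra.ι 𝕜 (UqGen.kPos 1) * FreeAlgebra.ι 𝕜 (UqGen.kPos 0))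
  | k_f₁ :
      UqRel 𝕜 q (FreeAlgebra.ι 𝕜 (UqGen.kPos 0) * FreeAlgebra.ι 𝕜 UqGen.f)
        (((q ^ (1 / 2 : ℝ) : ℝ) : 𝕜) •
          (FreeAlgebra.ι 𝕜 UqGen.f * FreeAlgebra.ι 𝕜 (UqGen.kPos 0)))
  | k_f₂ :
      UqRel 𝕜 q (FreeAlgebra.ι 𝕜 (UqGen.kPos 1) * FreeAlgebra.ι 𝕜 UqGen.f)
        (((q ^ (-(1 / 2) : ℝ) : ℝ) : 𝕜) •
          (FreeAlgebra.ι 𝕜 UqGen.f * FreeAlgebra.ι 𝕜 (UqGen.kPos 1)))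
  | k_e₁ :
      UqRel 𝕜 q (FreeAlgebra.ι 𝕜 (UqGen.kPos 0) * FreeAlgebra.ι 𝕜 UqGen.e)
        (((q ^ (-(1 / 2) : ℝ) : ℝ) : 𝕜) •
          (FreeAlgebra.ι 𝕜 UqGen.e * FreeAlgebra.ι 𝕜 (UqGen.kPos 0)))
  | k_e₂ :
      UqRel 𝕜 q (FreeAlgebra.ι 𝕜 (UqGen.kPos 1) * FreeAlgebra.ι 𝕜 UqGen.e)
        (((q ^ (1 / 2 : ℝ) : ℝ) : 𝕜) •
          (FreeAlgebra.ι 𝕜 UqGen.e * FreeAlgebra.ι 𝕜 (UqGen.kPos 1)))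
  | f_e :
      UqRel 𝕜 q
        (FreeAlgebra.ι 𝕜 UqGen.f * FreeAlgebra.ι 𝕜 UqGen.e
          - FreeAlgebra.ι 𝕜 UqGen.e * FreeAlgebra.ι 𝕜 UqGen.f)
        ((((q - q⁻¹)⁻¹ : ℝ) : 𝕜) • (freeQHalfH 𝕜 ^ 2 - freeQHalfHInv 𝕜 ^ 2))

/-- The quantum algebra `U_q(gl_2)`. -/
abbrev UqGl₂ (𝕜 : Type*) [RCLike 𝕜] (q : ℝ) : Type _ := RingQuot (UqRel 𝕜 q)

namespace UqGl₂

/-- The class of a generator in `U_q(gl_2)`. -/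
def gen (𝕜 : Type*) [RCLike 𝕜] (q : ℝ) (g : UqGen) : UqGl₂ 𝕜 q :=
  RingQuot.mkAlgHom 𝕜 (UqRel 𝕜 q) (FreeAlgebra.ι 𝕜 g)

/-- The element `q^h = (q^{ε_1/2} q^{-ε_2/2})^2`. -/
def qh (𝕜 : Type*) [RCLike 𝕜] (q : ℝ) : UqGl₂ 𝕜 q :=
  (gen 𝕜 q (UqGen.kPos 0) * gen 𝕜 q (UqGen.kNeg 1)) ^ 2

end UqGl₂

/-- A representation `ρ` of an algebra on a non-zero space `V` is irreducible if `0` and `V` are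
its only invariant subspaces. -/
def IsIrreducibleRep {𝕜 A V : Type*} [Field 𝕜] [Ring A] [Algebra 𝕜 A] [AddCommGroup V]
    [Module 𝕜 V] (ρ : A →ₐ[𝕜] Module.End 𝕜 V) : Prop :=
  Nontrivial V ∧
    ∀ W : Submodule 𝕜 V, (∀ u : A, ∀ w ∈ W, ρ u w ∈ W) → W = ⊥ ∨ W = ⊤

/-- A canonical basis `β_0, …, β_{d-1}` of a `d`-dimensional representation of `U_q(gl_2)`:
`f β_0 = 0`, `e β_{d-1} = 0`, `e β_i = β_{i+1}`, `f β_{i+1} = [i+1]_q [d-1-i]_q β_i` and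
`q^h β_i = q^{d-1-2i} β_i`. -/
def IsCanonicalBasis {𝕜 V : Type*} [RCLike 𝕜] [AddCommGroup V] [Module 𝕜 V] {q : ℝ} {d : ℕ}
    (ρ : UqGl₂ 𝕜 q →ₐ[𝕜] Module.End 𝕜 V) (β : Module.Basis (Fin d) 𝕜 V) : Prop :=
  (∀ i : Fin d, i.1 = 0 → ρ (UqGl₂.gen 𝕜 q UqGen.f) (β i) = 0) ∧
  (∀ i : Fin d, i.1 + 1 = d → ρ (UqGl₂.gen 𝕜 q UqGen.e) (β i) = 0) ∧
  (∀ i j : Fin d, j.1 = i.1 + 1 → ρ (UqGl₂.gen 𝕜 q UqGen.e) (β i) = β j) ∧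
  (∀ i j : Fin d, j.1 = i.1 + 1 → ρ (UqGl₂.gen 𝕜 q UqGen.f) (β j) =
    ((qInt q (i.1 + 1) * qInt q (d - 1 - i.1) : ℝ) : 𝕜) • β i) ∧
  (∀ i : Fin d, ρ (UqGl₂.qh 𝕜 q) (β i) = ((q ^ ((d : ℤ) - 1 - 2 * (i.1 : ℤ)) : ℝ) : 𝕜) • β i)

/-- The representation `ρ` of `U_q(gl_2)` on the subspace `V` of `(𝕜^n)^{⊗N}` is the restriction
to `V` of the action of `U_q(gl_2) ⊆ U_q(gl_n)` on `(𝕜^n)^{⊗N}`. -/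
def IsRestrictedAction {𝕜 : Type*} [RCLike 𝕜] {n : ℕ} (hn : 2 ≤ n) {N : ℕ} {q : ℝ}
    {V : Submodule 𝕜 (TensorSpace 𝕜 n N)} (ρ : UqGl₂ 𝕜 q →ₐ[𝕜] Module.End 𝕜 V) : Prop :=
  ∀ v : V,
    (ρ (UqGl₂.gen 𝕜 q UqGen.e) v : TensorSpace 𝕜 n N) = E₁ 𝕜 hn N q v ∧
    (ρ (UqGl₂.gen 𝕜 q UqGen.f) v : TensorSpace 𝕜 n N) = F₁ 𝕜 hn N q v ∧
    (ρ (UqGl₂.gen 𝕜 q (UqGen.kPos 0)) v : TensorSpace 𝕜 n N) = qEps 𝕜 N q (1 / 2) (x₁ hn) v ∧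
    (ρ (UqGl₂.gen 𝕜 q (UqGen.kNeg 0)) v : TensorSpace 𝕜 n N) = qEps 𝕜 N q (-(1 / 2)) (x₁ hn) v ∧
    (ρ (UqGl₂.gen 𝕜 q (UqGen.kPos 1)) v : TensorSpace 𝕜 n N) = qEps 𝕜 N q (1 / 2) (x₂ hn) v ∧
    (ρ (UqGl₂.gen 𝕜 q (UqGen.kNeg 1)) v : TensorSpace 𝕜 n N) = qEps 𝕜 N q (-(1 / 2)) (x₂ hn) v

/-! ### Eigenvalues and sectors -/

/-- `b` is an eigenvector of `𝓗` with eigenvalue `Λ` of the form `𝔟_{(N-k)k}`. -/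
def IsEigenstate {𝕜 : Type*} [RCLike 𝕜] {n : ℕ} (hn : 2 ≤ n) {N : ℕ} (k : ℕ) (q Λ : ℝ)
    (b : TensorSpace 𝕜 n N) : Prop :=
  b ∈ stateSpace 𝕜 hn N k ∧ b ≠ 0 ∧ hamiltonian 𝕜 n N q b = (Λ : 𝕜) • b

/-- The eigenvalues of the problem `𝓗 𝔟_{(N-k)k} = Λ 𝔟_{(N-k)k}`. -/
def eigenvalues (𝕜 : Type*) [RCLike 𝕜] {n : ℕ} (hn : 2 ≤ n) (N k : ℕ) (q : ℝ) : Set ℝ :=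
  {Λ | ∃ b : TensorSpace 𝕜 n N, IsEigenstate hn k q Λ b}

/-- The eigenvalues in the `k`-sector: those with an eigenstate `b` of the form `𝔟_{(N-k)k}` that
is a highest-weight vector, `F_1 b = 0`. -/
def sectorEigenvalues (𝕜 : Type*) [RCLike 𝕜] {n : ℕ} (hn : 2 ≤ n) (N k : ℕ) (q : ℝ) : Set ℝ :=
  {Λ | ∃ b : TensorSpace 𝕜 n N, IsEigenstate hn k q Λ b ∧ F₁ 𝕜 hn N q b = 0}

/-- `b_{(N-m)m} = E_1^{m-k} b` for `m ≥ k`. -/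
def orbitVec {𝕜 : Type*} [RCLike 𝕜] {n : ℕ} (hn : 2 ≤ n) {N : ℕ} (k : ℕ) (q : ℝ)
    (b : TensorSpace 𝕜 n N) (m : ℕ) : TensorSpace 𝕜 n N :=
  (E₁ 𝕜 hn N q ^ (m - k)) b

/-- The span of the orbit `b_{(N-m)m}`, `k ≤ m ≤ N - k`. -/
def orbitSpan {𝕜 : Type*} [RCLike 𝕜] {n : ℕ} (hn : 2 ≤ n) {N : ℕ} (k : ℕ) (q : ℝ)
    (b : TensorSpace 𝕜 n N) : Submodule 𝕜 (TensorSpace 𝕜 n N) :=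
  Submodule.span 𝕜 (orbitVec hn k q b '' Set.Icc k (N - k))

end SpinChain

end

namespace SpinChain

/-! ### Action of tensor products and of the braid operator on words -/

section WordAction

variable {𝕜 : Type*} [RCLike 𝕜] {n N : ℕ}

/-! The proof rests on three facts about the words in $x_1,x_2$, each checked on basis vectors.
First, $F_1$ is the adjoint of $E_1$, and $\mathcal H$ is self-adjoint (`inner_E₁`,
`inner_hamiltonian`). Second, $F_1E_1-E_1F_1$ is the scalar $[N-2m]_q$ on $W_m$ (`F₁_E₁_sub`): terms
at different sites cancel and the diagonal sum telescopes. Third, $\mathcal H$ commutes with $E_1$,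
by a two-site computation for each $r_j$ (`braidOp_raiseOp_add`), and hence with $F_1$ by taking
adjoints.

The first two facts give $\|E_1v\|^2=\|F_1v\|^2+[N-2m]_q\|v\|^2$ on $W_m$. Since $q>0$ makes
$[N-2m]_q$ positive for $2m<N$, $E_1$ is injective there. Its image in $W_{m+1}$ meets $\ker F_1$
trivially, so $\dim(\ker F_1\cap W_k)\le\binom Nk-\binom N{k-1}$, which bounds the number of sector
eigenvalues. For any other eigenvalue, $F_1b\ne0$ is an eigenvector in $W_{k-1}$, so there are at
most $\binom N{k-1}$ of those. The two bounds add up to $\binom Nk$, the total number of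
eigenvalues, so both are equalities. Distinctness also makes every eigenspace in $W_k$ a line, so
one eigenvector killed by $F_1$ decides for all.

The orbit of $b$ is the usual highest-weight string: the commutator gives the coefficients of $F_1$
by induction, and they are non-zero until the string ends. The orbit vectors lie in different $W_m$
and are therefore orthogonal. On their span $V$ the operator $F_1$ is nilpotent with kernel spanned
by $b$; hence a non-zero invariant subspace contains $b$ and so all of $V$. The relations of
$U_q(\mathfrak{gl}_2)$ need checking only on vectors in a single $W_m$, where the Cartan generators
are scalars. -/

theorem toEuclideanLin_wordVec (M : Matrix (Fin N → Fin n) (Fin N → Fin n) 𝕜)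
    (w w' : Fin N → Fin n) : Matrix.toEuclideanLin M (wordVec 𝕜 w') w = M w w' := by
  simp [wordVec]

/-- Column $w_l$ of each factor has at most one non-zero entry, in row $u_l$, so the expansion over
words has a single term. -/
theorem tensorOp_wordVec {A : Fin N → Matrix (Fin n) (Fin n) 𝕜} {w u : Fin N → Fin n}
    {a : Fin N → 𝕜} (h : ∀ l i, A l i (w l) = if i = u l then a l else 0) :
    tensorOp A (wordVec 𝕜 w) = (∏ l, a l) • wordVec 𝕜 u := by
  ext v
  refine (toEuclideanLin_wordVec (Matrix.of fun w w' => ∏ l, A l (w l) (w' l)) v w).trans ?_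
  simp only [Matrix.of_apply, h, wordVec, PiLp.smul_apply, PiLp.single_apply, smul_eq_mul, mul_ite,
    mul_one, mul_zero]
  split_ifs with hv
  · subst hv; simp
  · obtain ⟨l, hl⟩ := Function.ne_iff.1 hv
    exact Finset.prod_eq_zero (Finset.mem_univ l) (if_neg hl)

theorem rMatrix_apply (q : ℝ) (a b c d : Fin n) :
    rMatrix 𝕜 n q (a, b) (c, d) =
      (if a = b ∧ a = c ∧ a = d then 1 else 0)
      + ((q⁻¹ : ℝ) : 𝕜) * (if a ≠ b ∧ a = d ∧ b = c then 1 else 0)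
      + ((1 - (q ^ 2)⁻¹ : ℝ) : 𝕜) * (if b < a ∧ a = c ∧ b = d then 1 else 0) := by
  have h1 : (∑ x : Fin n, Matrix.single x x (1 : 𝕜) ⊗ₖ Matrix.single x x (1 : 𝕜)) (a, b) (c, d)
      = if a = b ∧ a = c ∧ a = d then 1 else 0 := by
    simp only [Matrix.sum_apply, Matrix.kroneckerMap_apply, Matrix.single_apply]
    rw [Finset.sum_eq_single a (by intro x _ hx; simp [hx]) (by simp)]
    by_cases h : a = b <;> by_cases h' : a = c <;> by_cases h'' : a = d <;> simp_all
  have h2 : (∑ x : Fin n, ∑ y : Fin n, if x ≠ y then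
        Matrix.single x y (1 : 𝕜) ⊗ₖ Matrix.single y x (1 : 𝕜) else 0) (a, b) (c, d)
      = if a ≠ b ∧ a = d ∧ b = c then 1 else 0 := by
    simp only [Matrix.sum_apply]
    rw [Finset.sum_eq_single a ?_ (by simp), Finset.sum_eq_single b ?_ (by simp)]
    · rw [apply_ite (fun M : Matrix (Fin n × Fin n) (Fin n × Fin n) 𝕜 => M (a, b) (c, d))]
      by_cases h : a = b <;> by_cases h' : a = d <;> by_cases h'' : b = c <;>
        simp [h, h', h'']
    · intro y _ hy
      split_ifs <;> simp [Matrix.single_apply, hy]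
    · intro x _ hx
      refine Finset.sum_eq_zero fun y _ => ?_
      split_ifs <;> simp [Matrix.single_apply, hx]
  have h3 : (∑ x : Fin n, ∑ y : Fin n, if y < x then
        Matrix.single x x (1 : 𝕜) ⊗ₖ Matrix.single y y (1 : 𝕜) else 0) (a, b) (c, d)
      = if b < a ∧ a = c ∧ b = d then 1 else 0 := by
    simp only [Matrix.sum_apply]
    rw [Finset.sum_eq_single a ?_ (by simp), Finset.sum_eq_single b ?_ (by simp)]
    · rw [apply_ite (fun M : Matrix (Fin n × Fin n) (Fin n × Fin n) 𝕜 => M (a, b) (c, d))]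
      by_cases h : b < a <;> by_cases h' : a = c <;> by_cases h'' : b = d <;>
        simp [h, h', h'']
    · intro y _ hy
      split_ifs <;> simp [Matrix.single_apply, hy]
    · intro x _ hx
      refine Finset.sum_eq_zero fun y _ => ?_
      split_ifs <;> simp [Matrix.single_apply, hx]
  rw [rMatrix, Matrix.add_apply, Matrix.add_apply, Matrix.smul_apply, Matrix.smul_apply, h1, h2, h3,
    smul_eq_mul, smul_eq_mul]

/-- The braid operator acting on the factors `i` and `j`. -/
noncomputable def braidOp (𝕜 : Type*) [RCLike 𝕜] (n : ℕ) {N : ℕ} (q : ℝ) (i j : Fin N) :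
    Module.End 𝕜 (TensorSpace 𝕜 n N) :=
  Matrix.toEuclideanLin (twoSite (rMatrix 𝕜 n q) i j)

theorem hamiltonian_eq_sum (q : ℝ) : hamiltonian 𝕜 n N q =
    ∑ j : Fin (N - 1), braidOp 𝕜 n q (⟨j.1, by omega⟩ : Fin N) (⟨j.1 + 1, by omega⟩ : Fin N) := by
  simp only [hamiltonian, braidOp, map_sum]

theorem wordVec_apply (w v : Fin N → Fin n) : wordVec 𝕜 w v = if v = w then 1 else 0 := by
  simp [wordVec]

/-- Has the shape of the condition in `twoSite`, so that matrix entries and coordinates split into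
the same cases. -/
theorem eq_iff_of_pair {i j : Fin N} {w v : Fin N → Fin n} :
    v = w ↔ (∀ l, l ≠ i → l ≠ j → v l = w l) ∧ v i = w i ∧ v j = w j := by
  constructor
  · rintro rfl; simp
  · rintro ⟨h, hi, hj⟩
    funext l
    by_cases h1 : l = i
    · rw [h1, hi]
    · by_cases h2 : l = j
      · rw [h2, hj]
      · exact h l h1 h2

theorem wordVec_apply_pair (i j : Fin N) (w v : Fin N → Fin n) : wordVec 𝕜 w v =
    if (∀ l, l ≠ i → l ≠ j → v l = w l) ∧ v i = w i ∧ v j = w j then 1 else 0 := by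
  rw [wordVec_apply]
  exact if_congr eq_iff_of_pair rfl rfl

theorem braidOp_wordVec_of_eq (q : ℝ) {i j : Fin N} {w : Fin N → Fin n} (h : w i = w j) :
    braidOp 𝕜 n q i j (wordVec 𝕜 w) = wordVec 𝕜 w := by
  ext v
  rw [braidOp, toEuclideanLin_wordVec, wordVec_apply_pair i j, twoSite, rMatrix_apply, h]
  by_cases h0 : ∀ l, l ≠ i → l ≠ j → v l = w l
  · rw [if_pos h0]
    by_cases h1 : v i = w j <;> by_cases h2 : v j = w j <;> simp_all
    intro h3; exact absurd (h3.symm) h2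
  · rw [if_neg h0, if_neg (fun hh => h0 hh.1)]

/-- The word `u` with the two letters exchanged is described by hypotheses, so that it can later be
given directly as the word of another subset. -/
theorem braidOp_wordVec_of_ne (q : ℝ) {i j : Fin N} {w u : Fin N → Fin n}
    (h : w i ≠ w j) (hu : ∀ l, l ≠ i → l ≠ j → u l = w l) (hi : u i = w j) (hj : u j = w i) :
    braidOp 𝕜 n q i j (wordVec 𝕜 w) = ((q⁻¹ : ℝ) : 𝕜) • wordVec 𝕜 u +
      (if w j < w i then ((1 - (q ^ 2)⁻¹ : ℝ) : 𝕜) else 0) • wordVec 𝕜 w := by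
  ext v
  rw [braidOp, toEuclideanLin_wordVec, twoSite, rMatrix_apply, PiLp.add_apply, PiLp.smul_apply,
    PiLp.smul_apply, wordVec_apply_pair i j, wordVec_apply_pair i j, hi, hj]
  by_cases h0 : ∀ l, l ≠ i → l ≠ j → v l = w l
  · have h0' : ∀ l, l ≠ i → l ≠ j → v l = u l := fun l h1 h2 => (h0 l h1 h2).trans (hu l h1 h2).symm
    rw [if_pos h0]
    have e1 : ¬ (v i = v j ∧ v i = w i ∧ v i = w j) := fun ⟨_, h1, h2⟩ => h (h1.symm.trans h2)
    have e2 : (v i ≠ v j ∧ v i = w j ∧ v j = w i) ↔ (v i = w j ∧ v j = w i) :=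
      ⟨fun hh => hh.2, fun hh => ⟨by rw [hh.1, hh.2]; exact h.symm, hh⟩⟩
    have e3 : (v j < v i ∧ v i = w i ∧ v j = w j) ↔ (w j < w i ∧ v i = w i ∧ v j = w j) :=
      ⟨fun hh => ⟨by rw [← hh.2.1, ← hh.2.2]; exact hh.1, hh.2⟩,
        fun hh => ⟨by rw [hh.2.1, hh.2.2]; exact hh.1, hh.2⟩⟩
    have e4 (X : Prop) : ((∀ l, l ≠ i → l ≠ j → v l = w l) ∧ X) ↔ X :=
      ⟨And.right, fun x => ⟨h0, x⟩⟩
    have e5 (X : Prop) : ((∀ l, l ≠ i → l ≠ j → v l = u l) ∧ X) ↔ X :=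
      ⟨And.right, fun x => ⟨h0', x⟩⟩
    simp only [e1, e2, e3, e4, e5, if_false, zero_add, smul_eq_mul]
    by_cases hh : w j < w i <;> simp [hh]
  · have h0' : ¬ ∀ l, l ≠ i → l ≠ j → v l = u l :=
      fun hh => h0 fun l h1 h2 => (hh l h1 h2).trans (hu l h1 h2)
    simp only [h0, h0', false_and, if_false]
    simp

end WordAction

/-! ### Exponents of the coproduct and real q-numbers -/

section SignSums

variable {N : ℕ}

/-- The sign of `m - l`. -/
noncomputable def posSign (m l : Fin N) : ℝ := if m < l then -1 else if m = l then 0 else 1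

theorem posSign_self (l : Fin N) : posSign l l = 0 := by simp [posSign]

theorem posSign_swap (m l : Fin N) : posSign m l = -posSign l m := by
  rcases lt_trichotomy m l with h | rfl | h
  · simp [posSign, h, h.not_gt, h.ne']
  · simp [posSign]
  · simp [posSign, h, h.not_gt, h.ne']

/-- The eigenvalue of `s_1` at the position `m` of the word of `S`. -/
noncomputable def spin (S : Finset (Fin N)) (m : Fin N) : ℝ := if m ∈ S then -1 else 1

/-- The exponent of the coefficient with which `E_1` or `F_1` acts at the position `l` of the word
of `S`. -/
noncomputable def weightExp (S : Finset (Fin N)) (l : Fin N) : ℝ :=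
  ∑ m, posSign m l * spin S m / 2

theorem weightExp_insert {S : Finset (Fin N)} {j : Fin N} (hj : j ∉ S) (l : Fin N) :
    weightExp (insert j S) l = weightExp S l - posSign j l := by
  suffices h : weightExp (insert j S) l - weightExp S l = -posSign j l by linarith
  rw [weightExp, weightExp, ← Finset.sum_sub_distrib, Finset.sum_eq_single j]
  · simp [spin, hj]; ring
  · intro m _ hm
    simp [spin, hm]
  · simp

theorem weightExp_insert_self {S : Finset (Fin N)} {l : Fin N} (hl : l ∉ S) :
    weightExp (insert l S) l = weightExp S l := by
  rw [weightExp_insert hl, posSign_self, sub_zero]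

/-- A site outside the pair lies on the same side of both neighbours and contributes equally; `i`
and `j` themselves contribute $\tfrac12$ each to the difference. -/
theorem weightExp_succ {T : Finset (Fin N)} {i j : Fin N} (hij : i.1 + 1 = j.1) (hi : i ∉ T)
    (hj : j ∉ T) : weightExp T i = weightExp T j + 1 := by
  have hlt : i < j := by rw [Fin.lt_def]; omega
  rw [← sub_eq_iff_eq_add', weightExp, weightExp, ← Finset.sum_sub_distrib,
    Fintype.sum_eq_add i j hlt.ne]
  · simp [posSign_self, spin, hi, hj]
    simp [posSign, hlt, hlt.not_gt, hlt.ne']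
    norm_num
  · rintro m ⟨hm1, hm2⟩
    have : posSign m i = posSign m j := by
      have h1 : m.1 ≠ i.1 := fun h => hm1 (Fin.ext h)
      have h2 : m.1 ≠ j.1 := fun h => hm2 (Fin.ext h)
      have : m < i ↔ m < j := by simp only [Fin.lt_def]; omega
      simp [posSign, this, hm1, hm2]
    rw [this, sub_self]

/-- The `q`-number of a real number. -/
noncomputable def qNum (q x : ℝ) : ℝ := if q = 1 then x else (q ^ x - q ^ (-x)) / (q - q⁻¹)

theorem sub_inv_ne_zero {q : ℝ} (hq : 0 < q) (h1 : q ≠ 1) : q - q⁻¹ ≠ 0 := by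
  intro h
  have h2 : q * q = 1 := by
    have := mul_inv_cancel₀ hq.ne'
    rw [sub_eq_zero] at h
    rwa [← h] at this
  exact h1 (by nlinarith)

theorem qNum_eq_of_mul {q x y : ℝ} (hq : 0 < q) (h1 : q ≠ 1)
    (h : (q - q⁻¹) * y = q ^ x - q ^ (-x)) : qNum q x = y := by
  rw [qNum, if_neg h1, ← h, mul_div_cancel_left₀ _ (sub_inv_ne_zero hq h1)]

theorem mul_qNum {q : ℝ} (hq : 0 < q) (h1 : q ≠ 1) (x : ℝ) :
    (q - q⁻¹) * qNum q x = q ^ x - q ^ (-x) := by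
  rw [qNum, if_neg h1, mul_div_cancel₀ _ (sub_inv_ne_zero hq h1)]

theorem qInt_eq_qNum (q : ℝ) (m : ℕ) : qInt q m = qNum q m := by
  unfold qInt qNum
  split_ifs with h
  · rfl
  · by_cases hq : 0 ≤ q
    · rw [Real.rpow_neg hq, Real.rpow_natCast]
    · have : q ^ (-(m : ℝ)) = (q ^ m)⁻¹ := by
        rw [show (-(m : ℝ)) = ((-(m : ℤ) : ℤ) : ℝ) by push_cast; ring, Real.rpow_intCast]; simp
      rw [this, Real.rpow_natCast]

theorem qNum_add_one {q : ℝ} (hq : 0 < q) (x : ℝ) : qNum q (x + 1) = q ^ x + q⁻¹ * qNum q x := by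
  by_cases h1 : q = 1
  · subst h1; simp [qNum]; ring
  · apply qNum_eq_of_mul hq h1
    rw [mul_add, mul_left_comm, mul_qNum hq h1, neg_add, Real.rpow_add hq, Real.rpow_add hq,
      Real.rpow_neg_one, Real.rpow_one]
    ring

theorem qNum_sub_one {q : ℝ} (hq : 0 < q) (x : ℝ) : qNum q (x - 1) = -q ^ x + q * qNum q x := by
  have := qNum_add_one hq (x - 1)
  rw [sub_add_cancel, Real.rpow_sub_one hq.ne'] at this
  rw [this]
  field_simp
  ring

/-- The induction step for the coefficients of $F_1$ on the orbit: adding the commutator turns one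
product of q-numbers into the next. -/
theorem qNum_mul_add {q : ℝ} (hq : 0 < q) (x y : ℝ) :
    qNum q x * qNum q (y + 1) + qNum q (y - x) = qNum q (x + 1) * qNum q y := by
  by_cases h1 : q = 1
  · subst h1; simp [qNum]; ring
  · have hd := sub_inv_ne_zero hq h1
    have hx := Real.rpow_pos_of_pos hq x
    have hy := Real.rpow_pos_of_pos hq y
    refine mul_left_cancel₀ (mul_ne_zero hd hd) ?_
    calc _ = ((q - q⁻¹) * qNum q x) * ((q - q⁻¹) * qNum q (y + 1))
          + (q - q⁻¹) * ((q - q⁻¹) * qNum q (y - x)) := by ring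
      _ = ((q - q⁻¹) * qNum q (x + 1)) * ((q - q⁻¹) * qNum q y) := by
        simp only [mul_qNum hq h1, Real.rpow_neg hq.le, Real.rpow_add hq, Real.rpow_sub hq,
          Real.rpow_one]
        field_simp
        ring
      _ = _ := by ring

/-- Numerator and denominator are both negative for $q<1$ and both positive for $q>1$. All the
non-vanishing on the orbit and the injectivity of $E_1$ come from here. -/
theorem qNum_pos {q x : ℝ} (hq : 0 < q) (hx : 0 < x) : 0 < qNum q x := by
  unfold qNum
  split_ifs with h1
  · exact hx
  · rcases lt_or_gt_of_ne h1 with h | h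
    · apply div_pos_of_neg_of_neg
      · exact sub_neg.2 (Real.rpow_lt_rpow_of_exponent_gt hq h (by linarith))
      · exact sub_neg.2 (h.trans ((one_lt_inv₀ hq).2 h))
    · apply div_pos
      · exact sub_pos.2 (Real.rpow_lt_rpow_of_exponent_lt h (by linarith))
      · exact sub_pos.2 ((inv_lt_one_of_one_lt₀ h).trans h)

theorem qNum_zero (q : ℝ) : qNum q 0 = 0 := by simp [qNum]

/-- A telescoping sum, since $(q-q^{-1})\sigma=q^{\sigma}-q^{-\sigma}$ for $\sigma=\pm1$. The
induction splits off the first site, which multiplies the remaining sum by $q^{-\sigma_0}$; the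
recursions for $[s\pm1]_q$ then close it, including the case $q=1$. -/
theorem sum_spin_mul_rpow {q : ℝ} (hq : 0 < q) :
    ∀ {N : ℕ} (σ : Fin N → ℝ), (∀ l, σ l = 1 ∨ σ l = -1) →
      ∑ l, σ l * q ^ (∑ m, posSign m l * σ m) = qNum q (∑ l, σ l)
  | 0, σ, _ => by simp [qNum_zero]
  | N + 1, σ, hσ => by
    have ih := sum_spin_mul_rpow hq (fun l => σ (Fin.succ l)) fun l => hσ _
    have h0 : ∀ m : Fin N, posSign m.succ 0 = 1 := fun m => by simp [posSign]
    have h1 : ∀ m : Fin N, posSign 0 m.succ = -1 := fun m => by simp [posSign]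
    have h2 : ∀ m l : Fin N, posSign m.succ l.succ = posSign m l := fun m l => by simp [posSign]
    simp only [Fin.sum_univ_succ, posSign_self, h0, h1, h2, zero_mul, zero_add, one_mul]
    set s := ∑ l : Fin N, σ l.succ
    have h3 : ∑ l : Fin N, σ l.succ * q ^ (-1 * σ 0 + ∑ m : Fin N, posSign m l * σ m.succ)
        = q ^ (-σ 0) * qNum q s := by
      rw [← ih, Finset.mul_sum]
      refine Finset.sum_congr rfl fun l _ => ?_
      rw [Real.rpow_add hq, neg_one_mul]
      ring
    rw [h3]
    rcases hσ 0 with h | h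
    · rw [h, add_comm 1 s, qNum_add_one hq, Real.rpow_neg_one, one_mul]
    · rw [h, neg_add_eq_sub, qNum_sub_one hq, neg_neg, Real.rpow_one, neg_one_mul]

theorem spin_eq (S : Finset (Fin N)) (l : Fin N) : spin S l = 1 ∨ spin S l = -1 := by
  unfold spin; split_ifs <;> simp

theorem sum_spin (S : Finset (Fin N)) : ∑ l, spin S l = N - 2 * S.card := by
  have h : ∀ l, spin S l = 1 - 2 * (if l ∈ S then 1 else 0) := fun l => by
    unfold spin; split_ifs <;> norm_num
  simp only [h, Finset.sum_sub_distrib, ← Finset.mul_sum]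
  simp

theorem sum_spin_mul_weight {q : ℝ} (hq : 0 < q) (S : Finset (Fin N)) :
    ∑ l, spin S l * (q ^ weightExp S l * q ^ weightExp S l) = qNum q (N - 2 * S.card) := by
  rw [← sum_spin, ← sum_spin_mul_rpow hq _ (spin_eq S)]
  refine Finset.sum_congr rfl fun l _ => ?_
  rw [← Real.rpow_add hq, weightExp, ← Finset.sum_add_distrib]
  simp only [add_halves]

end SignSums

/-! ### Raising and lowering words, and their commutator -/

section SubsetWords

variable {𝕜 : Type*} [RCLike 𝕜] {n N : ℕ} (hn : 2 ≤ n)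

theorem x₁_ne_x₂ : x₁ hn ≠ x₂ hn := by simp [x₁, x₂]

theorem x₁_lt_x₂ : x₁ hn < x₂ hn := by simp [x₁, x₂]

theorem wordOf_of_mem {S : Finset (Fin N)} {l : Fin N} (h : l ∈ S) : wordOf hn S l = x₂ hn :=
  if_pos h

theorem wordOf_of_notMem {S : Finset (Fin N)} {l : Fin N} (h : l ∉ S) : wordOf hn S l = x₁ hn :=
  if_neg h

theorem wordOf_injective : Function.Injective (wordOf hn : Finset (Fin N) → Fin N → Fin n) := by
  intro S T h
  ext l
  have := congrFun h l
  unfold wordOf at this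
  have h12 := x₁_ne_x₂ hn
  by_cases h1 : l ∈ S <;> by_cases h2 : l ∈ T <;> simp_all [eq_comm]

/-- The basis vector of the word of `S`. -/
noncomputable def subsetVec (𝕜 : Type*) [RCLike 𝕜] (S : Finset (Fin N)) : TensorSpace 𝕜 n N :=
  wordVec 𝕜 (wordOf hn S)

theorem sDiag_wordOf (S : Finset (Fin N)) (l : Fin N) : sDiag hn (wordOf hn S l) = spin S l := by
  have h12 := x₁_ne_x₂ hn
  unfold wordOf spin sDiag
  split_ifs <;> simp [h12, h12.symm]

/-- The summand at the position `l` of the coproduct. -/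
noncomputable def siteOp (q : ℝ) (X : Matrix (Fin n) (Fin n) 𝕜) (j : Fin N) :
    Module.End 𝕜 (TensorSpace 𝕜 n N) :=
  tensorOp fun l =>
    if l < j then qDiag 𝕜 q (fun a => -(sDiag hn a) / 2)
    else if l = j then X
    else qDiag 𝕜 q (fun a => sDiag hn a / 2)

/-- The summand of `E_1` at the position `l`. -/
noncomputable def raiseOp (𝕜 : Type*) [RCLike 𝕜] (q : ℝ) (l : Fin N) :
    Module.End 𝕜 (TensorSpace 𝕜 n N) :=
  siteOp hn q (Matrix.single (x₂ hn) (x₁ hn) 1) l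

/-- The summand of `F_1` at the position `l`. -/
noncomputable def lowerOp (𝕜 : Type*) [RCLike 𝕜] (q : ℝ) (l : Fin N) :
    Module.End 𝕜 (TensorSpace 𝕜 n N) :=
  siteOp hn q (Matrix.single (x₁ hn) (x₂ hn) 1) l

theorem E₁_eq_sum (q : ℝ) : E₁ 𝕜 hn N q = ∑ l, raiseOp hn 𝕜 q l := rfl

theorem F₁_eq_sum (q : ℝ) : F₁ 𝕜 hn N q = ∑ l, lowerOp hn 𝕜 q l := rfl

/-- The value $a=0$ is allowed, so that one formula covers both the words that are changed at site
`j` and those that are annihilated. -/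
theorem siteOp_subsetVec {q : ℝ} (hq : 0 < q) {X : Matrix (Fin n) (Fin n) 𝕜} {S : Finset (Fin N)}
    {j : Fin N} {a : 𝕜} {w : Fin n} (h : ∀ i, X i (wordOf hn S j) = if i = w then a else 0) :
    siteOp hn q X j (subsetVec hn 𝕜 S) =
      (((q ^ weightExp S j : ℝ) : 𝕜) * a) • wordVec 𝕜 (Function.update (wordOf hn S) j w) := by
  rw [siteOp, subsetVec, tensorOp_wordVec
    (a := fun l => if l = j then a else ((q ^ (posSign l j * spin S l / 2) : ℝ) : 𝕜))
    (u := Function.update (wordOf hn S) j w)]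
  · congr 1
    rw [Fintype.prod_eq_mul_prod_compl j, if_pos rfl, mul_comm]
    congr 1
    rw [weightExp, Fintype.sum_eq_add_sum_compl j, posSign_self, zero_mul, zero_div, zero_add,
      Real.rpow_sum_of_pos hq, RCLike.ofReal_prod]
    refine Finset.prod_congr rfl fun l hl => if_neg (by simpa using hl)
  · intro l i
    have hd : ∀ c : Fin n → ℝ, qDiag 𝕜 q c i (wordOf hn S l) =
        if i = wordOf hn S l then ((q ^ c (wordOf hn S l) : ℝ) : 𝕜) else 0 := by
      intro c
      rw [qDiag, Matrix.diagonal_apply]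
      split_ifs with hi
      · rw [hi]
      · rfl
    rcases lt_trichotomy l j with hl | rfl | hl
    · rw [if_pos hl, if_neg hl.ne, Function.update_of_ne hl.ne, hd, sDiag_wordOf, posSign,
        if_pos hl, neg_one_mul]
    · rw [if_neg (lt_irrefl _), if_pos rfl, if_pos rfl, Function.update_self, h]
    · rw [if_neg hl.not_gt, if_neg hl.ne', if_neg hl.ne', Function.update_of_ne hl.ne', hd,
        sDiag_wordOf, posSign, if_neg hl.not_gt, if_neg hl.ne', one_mul]

theorem wordOf_insert (S : Finset (Fin N)) (l : Fin N) :
    wordOf hn (insert l S) = Function.update (wordOf hn S) l (x₂ hn) := by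
  funext m
  by_cases h : m = l
  · subst h; simp [wordOf]
  · simp [wordOf, h]

theorem wordOf_erase (S : Finset (Fin N)) (l : Fin N) :
    wordOf hn (S.erase l) = Function.update (wordOf hn S) l (x₁ hn) := by
  funext m
  by_cases h : m = l
  · subst h; simp [wordOf]
  · simp [wordOf, h]

theorem raiseOp_of_notMem {q : ℝ} (hq : 0 < q) {S : Finset (Fin N)} {l : Fin N} (hl : l ∉ S) :
    raiseOp hn 𝕜 q l (subsetVec hn 𝕜 S) =
      ((q ^ weightExp S l : ℝ) : 𝕜) • subsetVec hn 𝕜 (insert l S) := by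
  rw [raiseOp, siteOp_subsetVec hn hq (a := 1) (w := x₂ hn), mul_one, subsetVec, wordOf_insert]
  intro i
  rw [wordOf_of_notMem hn hl, Matrix.single_apply]
  simp [eq_comm]

theorem raiseOp_of_mem {q : ℝ} (hq : 0 < q) {S : Finset (Fin N)} {l : Fin N} (hl : l ∈ S) :
    raiseOp hn 𝕜 q l (subsetVec hn 𝕜 S) = 0 := by
  rw [raiseOp, siteOp_subsetVec hn hq (a := 0) (w := x₂ hn), mul_zero, zero_smul]
  intro i
  rw [wordOf_of_mem hn hl, Matrix.single_apply]
  simp [x₁_ne_x₂ hn]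

theorem lowerOp_of_mem {q : ℝ} (hq : 0 < q) {S : Finset (Fin N)} {l : Fin N} (hl : l ∈ S) :
    lowerOp hn 𝕜 q l (subsetVec hn 𝕜 S) =
      ((q ^ weightExp S l : ℝ) : 𝕜) • subsetVec hn 𝕜 (S.erase l) := by
  rw [lowerOp, siteOp_subsetVec hn hq (a := 1) (w := x₁ hn), mul_one, subsetVec, wordOf_erase]
  intro i
  rw [wordOf_of_mem hn hl, Matrix.single_apply]
  simp [eq_comm]

theorem lowerOp_of_notMem {q : ℝ} (hq : 0 < q) {S : Finset (Fin N)} {l : Fin N} (hl : l ∉ S) :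
    lowerOp hn 𝕜 q l (subsetVec hn 𝕜 S) = 0 := by
  rw [lowerOp, siteOp_subsetVec hn hq (a := 0) (w := x₁ hn), mul_zero, zero_smul]
  intro i
  rw [wordOf_of_notMem hn hl, Matrix.single_apply]
  simp [(x₁_ne_x₂ hn).symm]

theorem lowerOp_insert {q : ℝ} (hq : 0 < q) {S : Finset (Fin N)} {l : Fin N} (hl : l ∉ S) :
    lowerOp hn 𝕜 q l (subsetVec hn 𝕜 (insert l S)) =
      ((q ^ weightExp S l : ℝ) : 𝕜) • subsetVec hn 𝕜 S := by
  rw [lowerOp_of_mem hn hq (Finset.mem_insert_self l S), Finset.erase_insert hl,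
    weightExp_insert_self hl]

/-- Each operator sees the letter changed by the other only through its exponent. In the one
non-trivial case the two corrections are `posSign i l` and `posSign l i`, which cancel by
antisymmetry. -/
theorem commutator_lowerOp_raiseOp_of_ne {q : ℝ} (hq : 0 < q) (S : Finset (Fin N)) {i l : Fin N}
    (hil : i ≠ l) : lowerOp hn 𝕜 q i (raiseOp hn 𝕜 q l (subsetVec hn 𝕜 S)) =
      raiseOp hn 𝕜 q l (lowerOp hn 𝕜 q i (subsetVec hn 𝕜 S)) := by
  by_cases hi : i ∈ S
  · obtain ⟨T, hT, rfl⟩ : ∃ T, i ∉ T ∧ S = insert i T :=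
      ⟨S.erase i, Finset.notMem_erase i S, (Finset.insert_erase hi).symm⟩
    rw [lowerOp_insert hn hq hT, map_smul]
    by_cases hl : l ∈ T
    · rw [raiseOp_of_mem hn hq hl, raiseOp_of_mem hn hq (Finset.mem_insert_of_mem hl), map_zero,
        smul_zero]
    · rw [raiseOp_of_notMem hn hq hl, raiseOp_of_notMem hn hq (by simp [hl, hil.symm]), map_smul,
        Finset.insert_comm, lowerOp_insert hn hq (by simp [hT, hil]), smul_smul, smul_smul,
        weightExp_insert hT, weightExp_insert hl, ← RCLike.ofReal_mul, ← RCLike.ofReal_mul,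
        ← Real.rpow_add hq, ← Real.rpow_add hq, posSign_swap l i]
      congr 3
      ring
  · rw [lowerOp_of_notMem hn hq hi, map_zero]
    by_cases hl : l ∈ S
    · rw [raiseOp_of_mem hn hq hl, map_zero]
    · rw [raiseOp_of_notMem hn hq hl, map_smul, lowerOp_of_notMem hn hq (by simp [hi, hil]),
        smul_zero]

theorem commutator_lowerOp_raiseOp_self {q : ℝ} (hq : 0 < q) (S : Finset (Fin N)) (l : Fin N) :
    lowerOp hn 𝕜 q l (raiseOp hn 𝕜 q l (subsetVec hn 𝕜 S)) -
      raiseOp hn 𝕜 q l (lowerOp hn 𝕜 q l (subsetVec hn 𝕜 S)) =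
      ((spin S l * (q ^ weightExp S l * q ^ weightExp S l) : ℝ) : 𝕜) • subsetVec hn 𝕜 S := by
  by_cases hl : l ∈ S
  · obtain ⟨T, hT, rfl⟩ : ∃ T, l ∉ T ∧ S = insert l T :=
      ⟨S.erase l, Finset.notMem_erase l S, (Finset.insert_erase hl).symm⟩
    rw [lowerOp_insert hn hq hT, map_smul, raiseOp_of_mem hn hq hl, raiseOp_of_notMem hn hq hT,
      map_zero, zero_sub, smul_smul, weightExp_insert_self hT, spin, if_pos hl, ← neg_smul]
    simp
  · rw [lowerOp_of_notMem hn hq hl, map_zero, sub_zero, raiseOp_of_notMem hn hq hl, map_smul,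
      lowerOp_insert hn hq hl, smul_smul, spin, if_neg hl]
    simp

theorem F₁_E₁_sub_subsetVec {q : ℝ} (hq : 0 < q) (S : Finset (Fin N)) :
    F₁ 𝕜 hn N q (E₁ 𝕜 hn N q (subsetVec hn 𝕜 S)) - E₁ 𝕜 hn N q (F₁ 𝕜 hn N q (subsetVec hn 𝕜 S)) =
      ((qNum q (N - 2 * S.card) : ℝ) : 𝕜) • subsetVec hn 𝕜 S := by
  rw [← sum_spin_mul_weight hq, RCLike.ofReal_sum, Finset.sum_smul]
  simp only [← commutator_lowerOp_raiseOp_self hn hq, E₁_eq_sum, F₁_eq_sum, LinearMap.sum_apply,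
    map_sum]
  rw [Finset.sum_comm, ← Finset.sum_sub_distrib]
  refine Finset.sum_congr rfl fun l _ => ?_
  rw [← Finset.sum_sub_distrib, Finset.sum_eq_single l]
  · intro i _ hi
    rw [commutator_lowerOp_raiseOp_of_ne hn hq S hi.symm, sub_self]
  · simp

/-! ### Commutation of the braid operators with E₁ -/

theorem braidOp_of_mem_iff (q : ℝ) {i j : Fin N} {S : Finset (Fin N)} (h : i ∈ S ↔ j ∈ S) :
    braidOp 𝕜 n q i j (subsetVec hn 𝕜 S) = subsetVec hn 𝕜 S := by
  apply braidOp_wordVec_of_eq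
  unfold wordOf
  simp only [h]

theorem braidOp_insert_left (q : ℝ) {i j : Fin N} (hij : i ≠ j) {T : Finset (Fin N)} (hi : i ∉ T)
    (hj : j ∉ T) : braidOp 𝕜 n q i j (subsetVec hn 𝕜 (insert i T)) =
      ((q⁻¹ : ℝ) : 𝕜) • subsetVec hn 𝕜 (insert j T) +
        ((1 - (q ^ 2)⁻¹ : ℝ) : 𝕜) • subsetVec hn 𝕜 (insert i T) := by
  have h12 := x₁_ne_x₂ hn
  rw [subsetVec, braidOp_wordVec_of_ne q (u := wordOf hn (insert j T)), if_pos]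
  · rfl
  all_goals simp [wordOf, hij, hij.symm, hi, hj, x₁_lt_x₂, h12.symm]
  intro l h1 h2
  simp [h1, h2]

theorem braidOp_insert_right (q : ℝ) {i j : Fin N} (hij : i ≠ j) {T : Finset (Fin N)} (hi : i ∉ T)
    (hj : j ∉ T) : braidOp 𝕜 n q i j (subsetVec hn 𝕜 (insert j T)) =
      ((q⁻¹ : ℝ) : 𝕜) • subsetVec hn 𝕜 (insert i T) := by
  have h12 := x₁_ne_x₂ hn
  rw [subsetVec, braidOp_wordVec_of_ne q (u := wordOf hn (insert i T)), if_neg, zero_smul, add_zero]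
  · rfl
  all_goals simp [wordOf, hij, hij.symm, hi, hj, (x₁_lt_x₂ hn).le, h12]
  intro l h1 h2
  simp [h1, h2]

theorem posSign_eq_of_succ {i j l : Fin N} (hij : i.1 + 1 = j.1) (hi : l ≠ i) (hj : l ≠ j) :
    posSign i l = posSign j l := by
  have h1 : l.1 ≠ i.1 := fun h => hi (Fin.ext h)
  have h2 : l.1 ≠ j.1 := fun h => hj (Fin.ext h)
  have : i < l ↔ j < l := by simp only [Fin.lt_def]; omega
  simp [posSign, this, hi.symm, hj.symm]

/-- Separates the letters at the pair from the rest of the word, leaving four local configurations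
for every two-site computation. -/
theorem exists_notMem_pair (i j : Fin N) (S : Finset (Fin N)) : ∃ T : Finset (Fin N),
    i ∉ T ∧ j ∉ T ∧ (S = T ∨ S = insert i T ∨ S = insert j T ∨ S = insert i (insert j T)) := by
  refine ⟨(S.erase i).erase j, by simp, by simp, ?_⟩
  by_cases hi : i ∈ S <;> by_cases hj : j ∈ S.erase i
  · right; right; right; rw [Finset.insert_erase hj, Finset.insert_erase hi]
  · right; left; rw [Finset.erase_eq_of_notMem hj, Finset.insert_erase hi]
  · right; right; left; rw [Finset.insert_erase hj, Finset.erase_eq_of_notMem hi]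
  · left; rw [Finset.erase_eq_of_notMem hj, Finset.erase_eq_of_notMem hi]

/-- As `i` and `j` are adjacent, `l` is on the same side of both. The exponent at `l` thus depends
only on how many $x_2$ the pair carries, and $r$ preserves that number. -/
theorem braidOp_raiseOp_of_ne {q : ℝ} (hq : 0 < q) {i j l : Fin N} (hij : i.1 + 1 = j.1)
    (hli : l ≠ i) (hlj : l ≠ j) (S : Finset (Fin N)) :
    braidOp 𝕜 n q i j (raiseOp hn 𝕜 q l (subsetVec hn 𝕜 S)) =
      raiseOp hn 𝕜 q l (braidOp 𝕜 n q i j (subsetVec hn 𝕜 S)) := by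
  have hne : i ≠ j := fun h => by rw [h] at hij; omega
  obtain ⟨T, hi, hj, hS⟩ := exists_notMem_pair i j S
  by_cases hl : l ∈ T
  · have h0 : ∀ U, T ⊆ U → raiseOp hn 𝕜 q l (subsetVec hn 𝕜 U) = 0 := fun U hU =>
      raiseOp_of_mem hn hq (hU hl)
    have h1 := h0 T subset_rfl
    have h2 := h0 _ (Finset.subset_insert i T)
    have h3 := h0 _ (Finset.subset_insert j T)
    have h4 := h0 _ ((Finset.subset_insert j T).trans (Finset.subset_insert i _))
    rcases hS with rfl | rfl | rfl | rfl
    · rw [braidOp_of_mem_iff hn q (by simp [hi, hj]), h1, map_zero]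
    · rw [braidOp_insert_left hn q hne hi hj, map_add, map_smul, map_smul, h2, h3]; simp
    · rw [braidOp_insert_right hn q hne hi hj, map_smul, h2, h3]; simp
    · rw [braidOp_of_mem_iff hn q (by simp), h4, map_zero]
  · have hi' : i ∉ insert l T := by simp [hi, hli.symm]
    have hj' : j ∉ insert l T := by simp [hj, hlj.symm]
    have hl2 : l ∉ insert i T := by simp [hl, hli]
    have hl3 : l ∉ insert j T := by simp [hl, hlj]
    rcases hS with rfl | rfl | rfl | rfl
    · rw [braidOp_of_mem_iff hn q (by simp [hi, hj]), raiseOp_of_notMem hn hq hl, map_smul,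
        braidOp_of_mem_iff hn q (by simp [hi', hj'])]
    · rw [braidOp_insert_left hn q hne hi hj, map_add, map_smul, map_smul,
        raiseOp_of_notMem hn hq hl2, raiseOp_of_notMem hn hq hl3, map_smul, Finset.insert_comm,
        braidOp_insert_left hn q hne hi' hj', weightExp_insert hi, weightExp_insert hj,
        posSign_eq_of_succ hij hli hlj, Finset.insert_comm l j T]
      module
    · rw [braidOp_insert_right hn q hne hi hj, map_smul,
        raiseOp_of_notMem hn hq hl2, raiseOp_of_notMem hn hq hl3, map_smul, Finset.insert_comm,
        braidOp_insert_right hn q hne hi' hj', weightExp_insert hi, weightExp_insert hj,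
        posSign_eq_of_succ hij hli hlj, Finset.insert_comm l i T]
      module
    · rw [braidOp_of_mem_iff hn q (by simp), raiseOp_of_notMem hn hq (by simp [hl, hli, hlj]),
        map_smul, braidOp_of_mem_iff hn q (by simp)]

/-- This is the statement that $r$ commutes with the two-fold coproduct of $e_1$; the other sites
only supply a common factor. The two summands do not commute with $r$ separately. -/
theorem braidOp_raiseOp_add {q : ℝ} (hq : 0 < q) {i j : Fin N} (hij : i.1 + 1 = j.1)
    (S : Finset (Fin N)) :
    braidOp 𝕜 n q i j (raiseOp hn 𝕜 q i (subsetVec hn 𝕜 S) +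
        raiseOp hn 𝕜 q j (subsetVec hn 𝕜 S)) =
      raiseOp hn 𝕜 q i (braidOp 𝕜 n q i j (subsetVec hn 𝕜 S)) +
        raiseOp hn 𝕜 q j (braidOp 𝕜 n q i j (subsetVec hn 𝕜 S)) := by
  have hne : i ≠ j := fun h => by rw [h] at hij; omega
  have hlt : i < j := by rw [Fin.lt_def]; omega
  obtain ⟨T, hi, hj, hS⟩ := exists_notMem_pair i j S
  have hij' : i ∉ insert j T := by simp [hi, hne]
  have hji' : j ∉ insert i T := by simp [hj, hne.symm]
  have p1 : posSign i j = -1 := by simp [posSign, hlt]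
  have p2 : posSign j i = 1 := by simp [posSign, hlt.not_gt, hne.symm]
  have hw := weightExp_succ hij hi hj
  -- With this base exponent the weights at `i` and `j` in `T` are $q^{g+1}$ and $q^g$, so every
  -- coefficient below is $q^g$ times a Laurent polynomial in $q$.
  set g := weightExp T j
  have hqg : ((q ^ (g + 1) : ℝ) : 𝕜) = (q : 𝕜) * ((q ^ g : ℝ) : 𝕜) := by
    rw [Real.rpow_add_one hq.ne', RCLike.ofReal_mul, mul_comm]
  have hq0 : (q : 𝕜) ≠ 0 := RCLike.ofReal_ne_zero.2 hq.ne'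
  have h1i : raiseOp hn 𝕜 q i (subsetVec hn 𝕜 T) =
      ((q : 𝕜) * ((q ^ g : ℝ) : 𝕜)) • subsetVec hn 𝕜 (insert i T) := by
    rw [raiseOp_of_notMem hn hq hi, hw, hqg]
  have h1j : raiseOp hn 𝕜 q j (subsetVec hn 𝕜 T) =
      ((q ^ g : ℝ) : 𝕜) • subsetVec hn 𝕜 (insert j T) := raiseOp_of_notMem hn hq hj
  have h2i : raiseOp hn 𝕜 q i (subsetVec hn 𝕜 (insert i T)) = 0 :=
    raiseOp_of_mem hn hq (by simp)
  have h2j : raiseOp hn 𝕜 q j (subsetVec hn 𝕜 (insert i T)) =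
      ((q : 𝕜) * ((q ^ g : ℝ) : 𝕜)) • subsetVec hn 𝕜 (insert i (insert j T)) := by
    rw [raiseOp_of_notMem hn hq hji', weightExp_insert hi, p1, sub_neg_eq_add, hqg,
      Finset.insert_comm]
  have h3i : raiseOp hn 𝕜 q i (subsetVec hn 𝕜 (insert j T)) =
      ((q ^ g : ℝ) : 𝕜) • subsetVec hn 𝕜 (insert i (insert j T)) := by
    rw [raiseOp_of_notMem hn hq hij', weightExp_insert hj, p2, hw, add_sub_cancel_right]
  have h3j : raiseOp hn 𝕜 q j (subsetVec hn 𝕜 (insert j T)) = 0 :=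
    raiseOp_of_mem hn hq (by simp)
  have h4i : raiseOp hn 𝕜 q i (subsetVec hn 𝕜 (insert i (insert j T))) = 0 :=
    raiseOp_of_mem hn hq (by simp)
  have h4j : raiseOp hn 𝕜 q j (subsetVec hn 𝕜 (insert i (insert j T))) = 0 :=
    raiseOp_of_mem hn hq (by simp)
  have r1 := braidOp_of_mem_iff (𝕜 := 𝕜) hn q (S := T) (i := i) (j := j) (by simp [hi, hj])
  have r2 := braidOp_insert_left (𝕜 := 𝕜) hn q hne hi hj
  have r3 := braidOp_insert_right (𝕜 := 𝕜) hn q hne hi hj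
  have r4 := braidOp_of_mem_iff (𝕜 := 𝕜) hn q (S := insert i (insert j T)) (i := i) (j := j)
    (by simp)
  rcases hS with rfl | rfl | rfl | rfl
  -- For $x_1x_1$ the claim is that $q\,x_2x_1+x_1x_2$ is fixed by $r$.
  · rw [r1, map_add, h1i, h1j, map_smul, map_smul, r2, r3, smul_add, smul_smul, smul_smul,
      smul_smul, add_comm, ← add_assoc, add_right_comm, ← add_smul]
    congr 2
    · push_cast; field_simp; ring
    · push_cast; field_simp
  · rw [r2, h2i, h2j, zero_add, map_smul, r4, map_add, map_add, map_smul, map_smul, map_smul,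
      map_smul, h3i, h3j, h2i, h2j, smul_zero, smul_zero, add_zero, zero_add, smul_smul, smul_smul,
      ← add_smul]
    congr 1
    push_cast; field_simp; ring
  · rw [r3, h3i, h3j, add_zero, map_smul, r4, map_smul, map_smul, h2i, h2j, smul_zero, zero_add,
      smul_smul]
    congr 1
    push_cast; field_simp
  · rw [r4, h4i, h4j, add_zero, map_zero]

theorem braidOp_E₁_subsetVec {q : ℝ} (hq : 0 < q) {i j : Fin N} (hij : i.1 + 1 = j.1)
    (S : Finset (Fin N)) :
    braidOp 𝕜 n q i j (E₁ 𝕜 hn N q (subsetVec hn 𝕜 S)) =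
      E₁ 𝕜 hn N q (braidOp 𝕜 n q i j (subsetVec hn 𝕜 S)) := by
  have hne : i ≠ j := fun h => by rw [h] at hij; omega
  rw [E₁_eq_sum, LinearMap.sum_apply, LinearMap.sum_apply, map_sum, ← sub_eq_zero,
    ← Finset.sum_sub_distrib, Fintype.sum_eq_add i j hne]
  · rw [sub_add_sub_comm, ← map_add, braidOp_raiseOp_add hn hq hij, sub_self]
  · rintro l ⟨hli, hlj⟩
    rw [braidOp_raiseOp_of_ne hn hq hij hli hlj, sub_self]

theorem hamiltonian_E₁_subsetVec {q : ℝ} (hq : 0 < q) (S : Finset (Fin N)) :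
    hamiltonian 𝕜 n N q (E₁ 𝕜 hn N q (subsetVec hn 𝕜 S)) =
      E₁ 𝕜 hn N q (hamiltonian 𝕜 n N q (subsetVec hn 𝕜 S)) := by
  rw [hamiltonian_eq_sum, LinearMap.sum_apply, LinearMap.sum_apply, map_sum]
  exact Finset.sum_congr rfl fun l _ => braidOp_E₁_subsetVec hn hq rfl S

end SubsetWords

/-! ### Adjoints of E₁, F₁ and the Hamiltonian -/

section Adjoints

variable {𝕜 : Type*} [RCLike 𝕜] {n N : ℕ} (hn : 2 ≤ n)

theorem inner_toEuclideanLin (M : Matrix (Fin N → Fin n) (Fin N → Fin n) 𝕜)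
    (v w : TensorSpace 𝕜 n N) :
    inner 𝕜 (Matrix.toEuclideanLin M v) w = inner 𝕜 v (Matrix.toEuclideanLin M.conjTranspose w) := by
  rw [Matrix.toEuclideanLin_conjTranspose_eq_adjoint, LinearMap.adjoint_inner_right]

theorem inner_tensorOp (A : Fin N → Matrix (Fin n) (Fin n) 𝕜) (v w : TensorSpace 𝕜 n N) :
    inner 𝕜 (tensorOp A v) w = inner 𝕜 v (tensorOp (fun l => (A l).conjTranspose) w) := by
  have : tensorOp (fun l => (A l).conjTranspose) = Matrix.toEuclideanLin
      (Matrix.conjTranspose (Matrix.of fun w w' => ∏ l, A l (w l) (w' l))) := by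
    unfold tensorOp
    congr 1
    ext w w'
    simp [Matrix.conjTranspose_apply]
  rw [this, ← inner_toEuclideanLin]
  rfl

/-- The diagonal factors are real, so only `X` changes. With $e_{21}^*=e_{12}$ this makes $E_1$ and
$F_1$ adjoint. -/
theorem inner_siteOp (q : ℝ) (X : Matrix (Fin n) (Fin n) 𝕜) (j : Fin N)
    (v w : TensorSpace 𝕜 n N) :
    inner 𝕜 (siteOp hn q X j v) w = inner 𝕜 v (siteOp hn q X.conjTranspose j w) := by
  have hd : ∀ c : Fin n → ℝ, (qDiag 𝕜 q c).conjTranspose = qDiag 𝕜 q c := by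
    intro c
    rw [qDiag, Matrix.diagonal_conjTranspose]
    congr 1
    ext a
    simp
  rw [siteOp, inner_tensorOp, siteOp]
  congr 3
  funext l
  split_ifs <;> simp [hd]

theorem inner_E₁ (q : ℝ) (v w : TensorSpace 𝕜 n N) :
    inner 𝕜 (E₁ 𝕜 hn N q v) w = inner 𝕜 v (F₁ 𝕜 hn N q w) := by
  simp only [E₁_eq_sum, F₁_eq_sum, LinearMap.sum_apply, sum_inner, inner_sum, raiseOp, lowerOp,
    inner_siteOp, Matrix.conjTranspose_single, star_one]

theorem inner_F₁ (q : ℝ) (v w : TensorSpace 𝕜 n N) :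
    inner 𝕜 (F₁ 𝕜 hn N q v) w = inner 𝕜 v (E₁ 𝕜 hn N q w) := by
  rw [← inner_conj_symm, ← inner_E₁, inner_conj_symm]

theorem rMatrix_isHermitian (q : ℝ) : (rMatrix 𝕜 n q).IsHermitian := by
  refine Matrix.IsHermitian.ext ?_
  rintro ⟨a, b⟩ ⟨c, d⟩
  have e1 : (c = d ∧ c = a ∧ c = b) ↔ (a = b ∧ a = c ∧ a = d) := by
    constructor <;> rintro ⟨rfl, rfl, rfl⟩ <;> simp
  have e2 : (c ≠ d ∧ c = b ∧ d = a) ↔ (a ≠ b ∧ a = d ∧ b = c) := by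
    constructor <;> rintro ⟨h, rfl, rfl⟩ <;> exact ⟨h.symm, rfl, rfl⟩
  have e3 : (d < c ∧ c = a ∧ d = b) ↔ (b < a ∧ a = c ∧ b = d) := by
    constructor <;> rintro ⟨h, rfl, rfl⟩ <;> exact ⟨h, rfl, rfl⟩
  simp only [rMatrix_apply, e1, e2, e3]
  simp [apply_ite (starRingEnd 𝕜)]

theorem inner_braidOp (q : ℝ) (i j : Fin N) (v w : TensorSpace 𝕜 n N) :
    inner 𝕜 (braidOp 𝕜 n q i j v) w = inner 𝕜 v (braidOp 𝕜 n q i j w) := by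
  rw [braidOp, inner_toEuclideanLin]
  congr 3
  ext w w'
  rw [Matrix.conjTranspose_apply, twoSite, twoSite, apply_ite star, star_zero]
  simp only [(rMatrix_isHermitian q).apply]
  congr 1
  simp only [eq_comm]

theorem inner_hamiltonian (q : ℝ) (v w : TensorSpace 𝕜 n N) :
    inner 𝕜 (hamiltonian 𝕜 n N q v) w = inner 𝕜 v (hamiltonian 𝕜 n N q w) := by
  simp only [hamiltonian_eq_sum, LinearMap.sum_apply, sum_inner, inner_sum, inner_braidOp]

end Adjoints

/-! ### The subspaces with a fixed number of letters x₂ -/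

section Sectors

variable {𝕜 : Type*} [RCLike 𝕜] {n N : ℕ} (hn : 2 ≤ n)

theorem subsetVec_mem_stateSpace (S : Finset (Fin N)) :
    subsetVec hn 𝕜 S ∈ stateSpace 𝕜 hn N S.card :=
  Submodule.subset_span ⟨S, rfl, rfl⟩

theorem stateSpace_le {m : ℕ} {U : Submodule 𝕜 (TensorSpace 𝕜 n N)}
    (h : ∀ S : Finset (Fin N), S.card = m → subsetVec hn 𝕜 S ∈ U) : stateSpace 𝕜 hn N m ≤ U := by
  rw [stateSpace, Submodule.span_le]
  rintro _ ⟨S, hS, rfl⟩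
  exact h S hS

theorem map_mem_of_stateSpace {m : ℕ} {A : Module.End 𝕜 (TensorSpace 𝕜 n N)}
    {U : Submodule 𝕜 (TensorSpace 𝕜 n N)}
    (h : ∀ S : Finset (Fin N), S.card = m → A (subsetVec hn 𝕜 S) ∈ U)
    {v : TensorSpace 𝕜 n N} (hv : v ∈ stateSpace 𝕜 hn N m) : A v ∈ U :=
  stateSpace_le hn (U := U.comap A) h hv

theorem eq_of_stateSpace {m : ℕ} {A B : Module.End 𝕜 (TensorSpace 𝕜 n N)}
    (h : ∀ S : Finset (Fin N), S.card = m → A (subsetVec hn 𝕜 S) = B (subsetVec hn 𝕜 S))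
    {v : TensorSpace 𝕜 n N} (hv : v ∈ stateSpace 𝕜 hn N m) : A v = B v :=
  stateSpace_le hn (U := LinearMap.eqLocus A B) h hv

theorem inner_subsetVec (S T : Finset (Fin N)) :
    inner 𝕜 (subsetVec (n := n) hn 𝕜 S) (subsetVec hn 𝕜 T) = if S = T then 1 else 0 := by
  rw [subsetVec, subsetVec, wordVec, wordVec, EuclideanSpace.inner_single_left]
  simp [(wordOf_injective hn).eq_iff]

theorem orthonormal_subsetVec :
    Orthonormal 𝕜 (subsetVec hn 𝕜 : Finset (Fin N) → TensorSpace 𝕜 n N) :=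
  orthonormal_iff_ite.2 (inner_subsetVec hn)

theorem finrank_stateSpace (m : ℕ) :
    Module.finrank 𝕜 (stateSpace 𝕜 hn N m : Submodule 𝕜 (TensorSpace 𝕜 n N)) = N.choose m := by
  have h1 : stateSpace 𝕜 hn N m =
      Submodule.span 𝕜 (Set.range fun S : {S : Finset (Fin N) // S.card = m} =>
        (subsetVec hn 𝕜 S.1 : TensorSpace 𝕜 n N)) := by
    rw [stateSpace]
    congr 1
    ext v
    constructor
    · rintro ⟨S, hS, rfl⟩; exact ⟨⟨S, hS⟩, rfl⟩
    · rintro ⟨⟨S, hS⟩, rfl⟩; exact ⟨S, hS, rfl⟩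
  have h2 : LinearIndependent 𝕜 fun S : {S : Finset (Fin N) // S.card = m} =>
      (subsetVec hn 𝕜 S.1 : TensorSpace 𝕜 n N) :=
    (orthonormal_subsetVec hn).linearIndependent.comp _ Subtype.val_injective
  rw [h1, finrank_span_eq_card h2, Fintype.card_finset_len, Fintype.card_fin]

theorem inner_eq_zero_of_stateSpace {m m' : ℕ} (h : m ≠ m') {v w : TensorSpace 𝕜 n N}
    (hv : v ∈ stateSpace 𝕜 hn N m) (hw : w ∈ stateSpace 𝕜 hn N m') : inner 𝕜 v w = 0 := by
  refine (Submodule.isOrtho_span.2 ?_ : stateSpace 𝕜 hn N m ⟂ stateSpace 𝕜 hn N m')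
    |>.inner_eq hv hw
  rintro _ ⟨S, hS, rfl⟩ _ ⟨T, hT, rfl⟩
  rw [← subsetVec, ← subsetVec, inner_subsetVec, if_neg]
  rintro rfl
  exact h (hS.symm.trans hT)

variable {q : ℝ} (hq : 0 < q) {m : ℕ} {v : TensorSpace 𝕜 n N}

include hq in
theorem E₁_mem (hv : v ∈ stateSpace 𝕜 hn N m) : E₁ 𝕜 hn N q v ∈ stateSpace 𝕜 hn N (m + 1) := by
  refine map_mem_of_stateSpace hn (fun S hS => ?_) hv
  rw [E₁_eq_sum, LinearMap.sum_apply]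
  refine Submodule.sum_mem _ fun l _ => ?_
  by_cases hl : l ∈ S
  · rw [raiseOp_of_mem hn hq hl]; exact zero_mem _
  · rw [raiseOp_of_notMem hn hq hl, ← hS, ← Finset.card_insert_of_notMem hl]
    exact Submodule.smul_mem _ _ (subsetVec_mem_stateSpace hn _)

include hq in
-- The truncated `m - 1` does no harm at `m = 0`, where $F_1$ vanishes.
theorem F₁_mem (hv : v ∈ stateSpace 𝕜 hn N m) : F₁ 𝕜 hn N q v ∈ stateSpace 𝕜 hn N (m - 1) := by
  refine map_mem_of_stateSpace hn (fun S hS => ?_) hv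
  rw [F₁_eq_sum, LinearMap.sum_apply]
  refine Submodule.sum_mem _ fun l _ => ?_
  by_cases hl : l ∈ S
  · rw [lowerOp_of_mem hn hq hl, ← hS, ← Finset.card_erase_of_mem hl]
    exact Submodule.smul_mem _ _ (subsetVec_mem_stateSpace hn _)
  · rw [lowerOp_of_notMem hn hq hl]; exact zero_mem _

include hq in
theorem F₁_eq_zero (hv : v ∈ stateSpace 𝕜 hn N 0) : F₁ 𝕜 hn N q v = 0 := by
  refine (Submodule.mem_bot 𝕜).1 (map_mem_of_stateSpace hn (fun S hS => ?_) hv)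
  rw [F₁_eq_sum, LinearMap.sum_apply]
  refine Submodule.sum_mem _ fun l _ => ?_
  rw [lowerOp_of_notMem hn hq (by simp [Finset.card_eq_zero.1 hS])]
  exact zero_mem _

theorem braidOp_subsetVec_mem (q : ℝ) {i j : Fin N} (hij : i ≠ j) (S : Finset (Fin N)) :
    braidOp 𝕜 n q i j (subsetVec hn 𝕜 S) ∈ stateSpace 𝕜 hn N S.card := by
  obtain ⟨T, hi, hj, rfl | rfl | rfl | rfl⟩ := exists_notMem_pair i j S
  · rw [braidOp_of_mem_iff hn q (by simp [hi, hj])]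
    exact subsetVec_mem_stateSpace hn _
  · have h1 := subsetVec_mem_stateSpace (𝕜 := 𝕜) hn (insert i T)
    have h2 := subsetVec_mem_stateSpace (𝕜 := 𝕜) hn (insert j T)
    rw [braidOp_insert_left hn q hij hi hj]
    rw [Finset.card_insert_of_notMem hj, ← Finset.card_insert_of_notMem hi] at h2
    exact Submodule.add_mem _ (Submodule.smul_mem _ _ h2) (Submodule.smul_mem _ _ h1)
  · have h2 := subsetVec_mem_stateSpace (𝕜 := 𝕜) hn (insert i T)
    rw [braidOp_insert_right hn q hij hi hj]
    rw [Finset.card_insert_of_notMem hi, ← Finset.card_insert_of_notMem hj] at h2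
    exact Submodule.smul_mem _ _ h2
  · rw [braidOp_of_mem_iff hn q (by simp)]
    exact subsetVec_mem_stateSpace hn _

theorem hamiltonian_mem (hv : v ∈ stateSpace 𝕜 hn N m) :
    hamiltonian 𝕜 n N q v ∈ stateSpace 𝕜 hn N m := by
  refine map_mem_of_stateSpace hn (fun S hS => ?_) hv
  rw [hamiltonian_eq_sum, LinearMap.sum_apply, ← hS]
  exact Submodule.sum_mem _ fun l _ => braidOp_subsetVec_mem hn q (by simp) S

include hq in
theorem F₁_E₁_sub (hv : v ∈ stateSpace 𝕜 hn N m) :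
    F₁ 𝕜 hn N q (E₁ 𝕜 hn N q v) - E₁ 𝕜 hn N q (F₁ 𝕜 hn N q v) =
      ((qNum q (N - 2 * m) : ℝ) : 𝕜) • v :=
  eq_of_stateSpace hn (A := F₁ 𝕜 hn N q * E₁ 𝕜 hn N q - E₁ 𝕜 hn N q * F₁ 𝕜 hn N q)
    (B := ((qNum q (N - 2 * m) : ℝ) : 𝕜) • 1)
    (fun S hS => by rw [← hS]; exact F₁_E₁_sub_subsetVec hn hq S) hv

include hq in
theorem hamiltonian_E₁ (hv : v ∈ stateSpace 𝕜 hn N m) :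
    hamiltonian 𝕜 n N q (E₁ 𝕜 hn N q v) = E₁ 𝕜 hn N q (hamiltonian 𝕜 n N q v) :=
  eq_of_stateSpace hn (A := hamiltonian 𝕜 n N q * E₁ 𝕜 hn N q)
    (B := E₁ 𝕜 hn N q * hamiltonian 𝕜 n N q) (fun S _ => hamiltonian_E₁_subsetVec hn hq S) hv

include hq in
-- The adjoint of the commutation with $E_1$. That is known only on words in $x_1,x_2$, so the
-- difference $u$ is first placed in a sector; then $\langle u,u\rangle=\langle E_1\mathcal
-- Hu-\mathcal HE_1u,v\rangle=0$.
theorem hamiltonian_F₁ (hv : v ∈ stateSpace 𝕜 hn N m) :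
    hamiltonian 𝕜 n N q (F₁ 𝕜 hn N q v) = F₁ 𝕜 hn N q (hamiltonian 𝕜 n N q v) := by
  rw [← sub_eq_zero, ← inner_self_eq_zero (𝕜 := 𝕜)]
  have hu : hamiltonian 𝕜 n N q (F₁ 𝕜 hn N q v) - F₁ 𝕜 hn N q (hamiltonian 𝕜 n N q v) ∈
      stateSpace 𝕜 hn N (m - 1) :=
    Submodule.sub_mem _ (hamiltonian_mem hn (F₁_mem hn hq hv))
      (F₁_mem hn hq (hamiltonian_mem hn hv))
  set u := hamiltonian 𝕜 n N q (F₁ 𝕜 hn N q v) - F₁ 𝕜 hn N q (hamiltonian 𝕜 n N q v) with hu'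
  -- Only the second slot is expanded; the first stays $u$, to receive the adjoints.
  nth_rewrite 2 [hu']
  rw [inner_sub_right, ← inner_hamiltonian, ← inner_E₁, ← inner_E₁, ← inner_hamiltonian,
    hamiltonian_E₁ hn hq hu, sub_self]

theorem tensorOp_qDiag_subsetVec {q : ℝ} (hq : 0 < q) (c : Fin n → ℝ) (S : Finset (Fin N)) :
    tensorOp (fun _ => qDiag 𝕜 q c) (subsetVec hn 𝕜 S) =
      ((q ^ (∑ l, c (wordOf hn S l)) : ℝ) : 𝕜) • subsetVec hn 𝕜 S := by
  rw [subsetVec, tensorOp_wordVec (u := wordOf hn S)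
    (a := fun l => ((q ^ c (wordOf hn S l) : ℝ) : 𝕜)), Real.rpow_sum_of_pos hq, RCLike.ofReal_prod]
  intro l i
  rw [qDiag, Matrix.diagonal_apply]
  split_ifs with hi
  · rw [hi]
  · rfl

include hq in
theorem qH₁_apply (hv : v ∈ stateSpace 𝕜 hn N m) :
    qH₁ 𝕜 hn N q v = ((q ^ ((N : ℤ) - 2 * (m : ℤ)) : ℝ) : 𝕜) • v := by
  refine eq_of_stateSpace hn (B := ((q ^ ((N : ℤ) - 2 * (m : ℤ)) : ℝ) : 𝕜) • 1)
    (fun S hS => ?_) hv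
  rw [qH₁, tensorOp_qDiag_subsetVec hn hq]
  simp only [sDiag_wordOf, sum_spin, hS]
  rw [← Real.rpow_intCast]
  simp

include hq in
theorem qEps_x₁ (t : ℝ) (hv : v ∈ stateSpace 𝕜 hn N m) :
    qEps 𝕜 N q t (x₁ hn) v = ((q ^ (t * (N - m)) : ℝ) : 𝕜) • v := by
  refine eq_of_stateSpace hn (B := ((q ^ (t * (N - m : ℝ)) : ℝ) : 𝕜) • 1) (fun S hS => ?_) hv
  rw [qEps, tensorOp_qDiag_subsetVec hn hq]
  have h : ∀ l, (Pi.single (x₁ hn) t : Fin n → ℝ) (wordOf hn S l) =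
      t * (1 - if l ∈ S then 1 else 0) := fun l => by
    unfold wordOf
    split_ifs <;> simp [(x₁_ne_x₂ hn).symm]
  simp only [h, ← Finset.mul_sum, Finset.sum_sub_distrib]
  simp [hS]

include hq in
theorem qEps_x₂ (t : ℝ) (hv : v ∈ stateSpace 𝕜 hn N m) :
    qEps 𝕜 N q t (x₂ hn) v = ((q ^ (t * m) : ℝ) : 𝕜) • v := by
  refine eq_of_stateSpace hn (B := ((q ^ (t * m : ℝ) : ℝ) : 𝕜) • 1) (fun S hS => ?_) hv
  rw [qEps, tensorOp_qDiag_subsetVec hn hq]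
  have h : ∀ l, (Pi.single (x₂ hn) t : Fin n → ℝ) (wordOf hn S l) =
      t * (if l ∈ S then 1 else 0) := fun l => by
    unfold wordOf
    split_ifs <;> simp [x₁_ne_x₂ hn]
  simp only [h, ← Finset.mul_sum]
  simp [hS]

include hq in
-- Take the inner product of the commutator relation with $v$ and use that $E_1$ and $F_1$ are
-- adjoint.
theorem norm_E₁_sq (hv : v ∈ stateSpace 𝕜 hn N m) :
    ‖E₁ 𝕜 hn N q v‖ ^ 2 = ‖F₁ 𝕜 hn N q v‖ ^ 2 + qNum q (N - 2 * m) * ‖v‖ ^ 2 := by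
  have h := F₁_E₁_sub hn hq hv
  rw [sub_eq_iff_eq_add] at h
  have h2 : inner 𝕜 (E₁ 𝕜 hn N q v) (E₁ 𝕜 hn N q v) = _ := inner_E₁ hn q v (E₁ 𝕜 hn N q v)
  have h3 := inner_F₁ hn q v (F₁ 𝕜 hn N q v)
  rw [h, inner_add_right, ← h3, inner_smul_right, inner_self_eq_norm_sq_to_K,
    inner_self_eq_norm_sq_to_K, inner_self_eq_norm_sq_to_K] at h2
  rw [add_comm]
  exact_mod_cast h2

include hq in
theorem E₁_injOn (hm : 2 * m < N) (hv : v ∈ stateSpace 𝕜 hn N m) (h : E₁ 𝕜 hn N q v = 0) :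
    v = 0 := by
  have h1 := norm_E₁_sq hn hq hv
  have hpos : 0 < qNum q (N - 2 * m) := by
    apply qNum_pos hq
    have : (2 * m : ℝ) < N := by exact_mod_cast hm
    linarith
  rw [h, norm_zero] at h1
  by_contra hne
  have : 0 < ‖v‖ := norm_pos_iff.2 hne
  nlinarith [sq_nonneg ‖F₁ 𝕜 hn N q v‖, mul_pos hpos (pow_pos this 2)]

end Sectors

/-! ### The highest-weight string and its irreducibility -/

section Orbit

variable {𝕜 : Type*} [RCLike 𝕜] {n N : ℕ} (hn : 2 ≤ n) {q : ℝ} {k : ℕ} {b : TensorSpace 𝕜 n N}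

theorem orbitVec_zero : orbitVec hn k q b k = b := by simp [orbitVec]

theorem orbitVec_succ (i : ℕ) :
    orbitVec hn k q b (k + (i + 1)) = E₁ 𝕜 hn N q (orbitVec hn k q b (k + i)) := by
  simp [orbitVec, pow_succ']

theorem qNum_one {q : ℝ} (hq : 0 < q) : qNum q 1 = 1 := by
  simpa [qNum_zero] using qNum_add_one hq 0

theorem orbitVec_mem (hq : 0 < q) (hb : b ∈ stateSpace 𝕜 hn N k) (i : ℕ) :
    orbitVec hn k q b (k + i) ∈ stateSpace 𝕜 hn N (k + i) := by
  induction i with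
  | zero => rwa [add_zero, orbitVec_zero]
  | succ i ih => rw [orbitVec_succ]; exact E₁_mem hn hq ih

theorem hamiltonian_orbitVec (hq : 0 < q) (hb : b ∈ stateSpace 𝕜 hn N k) {Λ : 𝕜}
    (hΛ : hamiltonian 𝕜 n N q b = Λ • b) (i : ℕ) :
    hamiltonian 𝕜 n N q (orbitVec hn k q b (k + i)) = Λ • orbitVec hn k q b (k + i) := by
  induction i with
  | zero => rwa [add_zero, orbitVec_zero]
  | succ i ih => rw [orbitVec_succ, hamiltonian_E₁ hn hq (orbitVec_mem hn hq hb i), ih, map_smul]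

/-- Move $F_1$ past one $E_1$ at a time. There is no upper bound on `i`: at `2 * k + i = N` the
coefficient is zero, and this ends the string. -/
theorem F₁_orbitVec_succ (hq : 0 < q) (hb : b ∈ stateSpace 𝕜 hn N k) (hF : F₁ 𝕜 hn N q b = 0)
    (i : ℕ) : F₁ 𝕜 hn N q (orbitVec hn k q b (k + (i + 1))) =
      ((qNum q (i + 1) * qNum q (N - 2 * k - i) : ℝ) : 𝕜) • orbitVec hn k q b (k + i) := by
  induction i with
  | zero =>
    have h := F₁_E₁_sub hn hq hb
    rw [hF, map_zero, sub_zero] at h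
    rw [orbitVec_succ, add_zero, orbitVec_zero, h]
    simp [qNum_one hq]
  | succ i ih =>
    have h := F₁_E₁_sub hn hq (orbitVec_mem hn hq hb (i + 1))
    rw [sub_eq_iff_eq_add] at h
    rw [orbitVec_succ hn (i + 1), h, ih, map_smul, ← orbitVec_succ, ← add_smul,
      ← RCLike.ofReal_add]
    congr 2
    have := qNum_mul_add hq (i + 1) (N - 2 * k - (i + 1))
    push_cast
    rw [← this, add_comm, show (N - 2 * k - (i + 1) + 1 : ℝ) = N - 2 * k - i by ring,
      show (N - 2 * k - (i + 1) - (i + 1) : ℝ) = N - 2 * (k + (i + 1)) by ring]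

theorem orbitVec_ne_zero (hq : 0 < q) (hb : b ∈ stateSpace 𝕜 hn N k) (hF : F₁ 𝕜 hn N q b = 0)
    (hb0 : b ≠ 0) {i : ℕ} (hi : 2 * k + i ≤ N) : orbitVec hn k q b (k + i) ≠ 0 := by
  induction i with
  | zero => rwa [add_zero, orbitVec_zero]
  | succ i ih =>
    intro h0
    have h := F₁_orbitVec_succ hn hq hb hF i
    rw [h0, map_zero] at h
    have hN : (2 * k + (i + 1) : ℝ) ≤ N := by exact_mod_cast hi
    refine smul_ne_zero ?_ (ih (by omega)) h.symm
    rw [RCLike.ofReal_ne_zero]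
    exact (mul_pos (qNum_pos hq (by positivity)) (qNum_pos hq (by linarith))).ne'

/-- For the top vector $x$ one has $\|E_1x\|^2=\langle x,F_1E_1x\rangle=0$, because the coefficient
of $F_1E_1x$ contains $[0]_q$. -/
theorem E₁_orbitVec_top (hq : 0 < q) (hb : b ∈ stateSpace 𝕜 hn N k) (hF : F₁ 𝕜 hn N q b = 0)
    {i : ℕ} (hi : 2 * k + i = N) : E₁ 𝕜 hn N q (orbitVec hn k q b (k + i)) = 0 := by
  have h : F₁ 𝕜 hn N q (E₁ 𝕜 hn N q (orbitVec hn k q b (k + i))) = 0 := by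
    have h0 : (N - 2 * k - i : ℝ) = 0 := by rw [← hi]; push_cast; ring
    rw [← orbitVec_succ, F₁_orbitVec_succ hn hq hb hF, h0, qNum_zero]
    simp
  rw [← inner_self_eq_zero (𝕜 := 𝕜), inner_E₁, h, inner_zero_right]

theorem inner_orbitVec (hq : 0 < q) (hb : b ∈ stateSpace 𝕜 hn N k) {i j : ℕ} (h : i ≠ j) :
    inner 𝕜 (orbitVec hn k q b (k + i)) (orbitVec hn k q b (k + j)) = 0 :=
  inner_eq_zero_of_stateSpace hn (by omega) (orbitVec_mem hn hq hb i) (orbitVec_mem hn hq hb j)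

theorem orbitSpan_eq_span_range (hk : 2 * k ≤ N) : orbitSpan hn k q b =
    Submodule.span 𝕜 (Set.range fun i : Fin (N - 2 * k + 1) => orbitVec hn k q b (k + i.1)) := by
  rw [orbitSpan]
  congr 1
  ext v
  constructor
  · rintro ⟨m, ⟨h1, h2⟩, rfl⟩
    exact ⟨⟨m - k, by omega⟩, by simp only [Nat.add_sub_cancel' h1]⟩
  · rintro ⟨i, rfl⟩
    exact ⟨k + i.1, ⟨by omega, by omega⟩, rfl⟩

theorem orbitVec_mem_orbitSpan {i : ℕ} (hi : 2 * k + i ≤ N) :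
    orbitVec hn k q b (k + i) ∈ orbitSpan hn k q b :=
  Submodule.subset_span ⟨k + i, ⟨by omega, by omega⟩, rfl⟩

theorem orbitSpan_le (hk : 2 * k ≤ N) {U : Submodule 𝕜 (TensorSpace 𝕜 n N)}
    (h : ∀ i, 2 * k + i ≤ N → orbitVec hn k q b (k + i) ∈ U) : orbitSpan hn k q b ≤ U := by
  rw [orbitSpan_eq_span_range hn hk, Submodule.span_le]
  rintro _ ⟨i, rfl⟩
  exact h i (by omega)

theorem exists_basis_orbitSpan (hq : 0 < q) (hk : 2 * k ≤ N) (hb : b ∈ stateSpace 𝕜 hn N k)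
    (hF : F₁ 𝕜 hn N q b = 0) (hb0 : b ≠ 0) :
    ∃ β : Module.Basis (Fin (N - 2 * k + 1)) 𝕜 (orbitSpan hn k q b),
      ∀ i, (β i : TensorSpace 𝕜 n N) = orbitVec hn k q b (k + i.1) := by
  have hli : LinearIndependent 𝕜
      fun i : Fin (N - 2 * k + 1) => orbitVec hn k q b (k + i.1) :=
    linearIndependent_of_ne_zero_of_inner_eq_zero
      (fun i => orbitVec_ne_zero hn hq hb hF hb0 (by omega))
      (fun i j hij => inner_orbitVec hn hq hb fun h => hij (Fin.ext h))
  refine ⟨(Module.Basis.span hli).map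
    (LinearEquiv.ofEq _ _ (orbitSpan_eq_span_range hn hk).symm), fun i => ?_⟩
  rw [Module.Basis.map_apply, LinearEquiv.coe_ofEq_apply, Module.Basis.span_apply]

theorem E₁_mem_orbitSpan (hq : 0 < q) (hk : 2 * k ≤ N) (hb : b ∈ stateSpace 𝕜 hn N k)
    (hF : F₁ 𝕜 hn N q b = 0) {v : TensorSpace 𝕜 n N} (hv : v ∈ orbitSpan hn k q b) :
    E₁ 𝕜 hn N q v ∈ orbitSpan hn k q b := by
  refine orbitSpan_le hn hk (U := (orbitSpan hn k q b).comap (E₁ 𝕜 hn N q)) (fun i hi => ?_) hv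
  rw [Submodule.mem_comap]
  rcases hi.eq_or_lt with h | h
  · rw [E₁_orbitVec_top hn hq hb hF h]; exact zero_mem _
  · rw [← orbitVec_succ]; exact orbitVec_mem_orbitSpan hn h

theorem F₁_mem_orbitSpan (hq : 0 < q) (hk : 2 * k ≤ N) (hb : b ∈ stateSpace 𝕜 hn N k)
    (hF : F₁ 𝕜 hn N q b = 0) {v : TensorSpace 𝕜 n N} (hv : v ∈ orbitSpan hn k q b) :
    F₁ 𝕜 hn N q v ∈ orbitSpan hn k q b := by
  refine orbitSpan_le hn hk (U := (orbitSpan hn k q b).comap (F₁ 𝕜 hn N q)) (fun i hi => ?_) hv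
  rw [Submodule.mem_comap]
  cases i with
  | zero => rw [add_zero, orbitVec_zero, hF]; exact zero_mem _
  | succ i =>
    rw [F₁_orbitVec_succ hn hq hb hF]
    exact Submodule.smul_mem _ _ (orbitVec_mem_orbitSpan hn (by omega))

theorem F₁_pow_orbitVec (hq : 0 < q) (hb : b ∈ stateSpace 𝕜 hn N k) (hF : F₁ 𝕜 hn N q b = 0)
    (i : ℕ) : (F₁ 𝕜 hn N q ^ (i + 1)) (orbitVec hn k q b (k + i)) = 0 := by
  induction i with
  | zero => rwa [add_zero, orbitVec_zero, zero_add, pow_one]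
  | succ i ih => rw [pow_succ, Module.End.mul_apply, F₁_orbitVec_succ hn hq hb hF, map_smul, ih,
      smul_zero]

theorem F₁_pow_eq_zero (hq : 0 < q) (hk : 2 * k ≤ N) (hb : b ∈ stateSpace 𝕜 hn N k)
    (hF : F₁ 𝕜 hn N q b = 0) {v : TensorSpace 𝕜 n N} (hv : v ∈ orbitSpan hn k q b) :
    (F₁ 𝕜 hn N q ^ (N + 1)) v = 0 := by
  refine orbitSpan_le hn hk (U := LinearMap.ker (F₁ 𝕜 hn N q ^ (N + 1))) (fun i hi => ?_) hv
  -- The exponent `N + 1` serves all basis vectors at once: the `i`-th is already killed by the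
  -- power `i + 1`.
  rw [LinearMap.mem_ker, show N + 1 = (N - i) + (i + 1) by omega, pow_add, Module.End.mul_apply,
    F₁_pow_orbitVec hn hq hb hF, map_zero]

/-- A vector in $\ker F_1$ is orthogonal to the image of $E_1$, hence to every orbit vector except
$b$. After subtracting its projection to $b$, the rest lies in $V$ and is orthogonal to $V$, so it
vanishes. -/
theorem mem_span_singleton_of_F₁_eq_zero (hk : 2 * k ≤ N) (hb0 : b ≠ 0) {w : TensorSpace 𝕜 n N}
    (hq : 0 < q) (hb : b ∈ stateSpace 𝕜 hn N k)
    (hw : w ∈ orbitSpan hn k q b) (hFw : F₁ 𝕜 hn N q w = 0) : ∃ c : 𝕜, w = c • b := by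
  refine ⟨inner 𝕜 b w / inner 𝕜 b b, ?_⟩
  set c := inner 𝕜 b w / inner 𝕜 b b with hc
  have hbV : b ∈ orbitSpan hn k q b := by
    simpa [orbitVec_zero] using orbitVec_mem_orbitSpan hn (q := q) (b := b) (i := 0) hk
  have hperp : orbitSpan hn k q b ≤ (𝕜 ∙ (w - c • b))ᗮ := by
    refine orbitSpan_le hn hk fun i hi => ?_
    rw [Submodule.mem_orthogonal_singleton_iff_inner_left]
    cases i with
    | zero =>
      rw [add_zero, orbitVec_zero, inner_sub_right, inner_smul_right, hc,
        div_mul_cancel₀ _ (inner_self_ne_zero.2 hb0), sub_self]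
    | succ i =>
      have h := inner_orbitVec hn hq hb (i := i + 1) (j := 0) (by omega)
      rw [add_zero, orbitVec_zero] at h
      rw [inner_sub_right, inner_smul_right, h, orbitVec_succ, inner_E₁, hFw, inner_zero_right,
        mul_zero, sub_zero]
  have h := hperp (Submodule.sub_mem _ hw (Submodule.smul_mem _ c hbV))
  rw [Submodule.mem_orthogonal_singleton_iff_inner_left, inner_self_eq_zero, sub_eq_zero] at h
  exact h

theorem eq_bot_or_eq_orbitSpan (hq : 0 < q) (hk : 2 * k ≤ N) (hb : b ∈ stateSpace 𝕜 hn N k)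
    (hF : F₁ 𝕜 hn N q b = 0) (hb0 : b ≠ 0) {W : Submodule 𝕜 (TensorSpace 𝕜 n N)}
    (hWV : W ≤ orbitSpan hn k q b)
    (hW : ∀ w ∈ W, E₁ 𝕜 hn N q w ∈ W ∧ F₁ 𝕜 hn N q w ∈ W) :
    W = ⊥ ∨ W = orbitSpan hn k q b := by
  refine or_iff_not_imp_left.2 fun hbot => le_antisymm hWV ?_
  obtain ⟨w, hwW, hw0⟩ := Submodule.exists_mem_ne_zero_of_ne_bot hbot
  -- Otherwise all powers of $F_1$ would keep $w$ non-zero, against nilpotency on $V$.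
  obtain ⟨u, huW, hu0, hFu⟩ : ∃ u ∈ W, u ≠ 0 ∧ F₁ 𝕜 hn N q u = 0 := by
    by_contra! hcon
    have h : ∀ j : ℕ, (F₁ 𝕜 hn N q ^ j) w ∈ W ∧ (F₁ 𝕜 hn N q ^ j) w ≠ 0 := by
      intro j
      induction j with
      | zero => exact ⟨hwW, hw0⟩
      | succ j ih =>
        rw [pow_succ', Module.End.mul_apply]
        exact ⟨(hW _ ih.1).2, hcon _ ih.1 ih.2⟩
    exact (h (N + 1)).2 (F₁_pow_eq_zero hn hq hk hb hF (hWV hwW))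
  obtain ⟨c, rfl⟩ := mem_span_singleton_of_F₁_eq_zero hn hk hb0 hq hb (hWV huW) hFu
  have hc : c ≠ 0 := fun h => hu0 (by rw [h, zero_smul])
  have hbW : b ∈ W := (Submodule.smul_mem_iff _ hc).1 huW
  refine orbitSpan_le hn hk fun i _ => ?_
  induction i with
  | zero => rwa [add_zero, orbitVec_zero]
  | succ i ih => rw [orbitVec_succ]; exact (hW _ (ih (by omega))).1

end Orbit

/-! ### The action of the quantum algebra on homogeneous subspaces -/

section QuantumAlgebra

variable {𝕜 : Type*} [RCLike 𝕜] {n N : ℕ} (hn : 2 ≤ n) {q : ℝ} (hq : 0 < q) {m : ℕ}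
  {v : TensorSpace 𝕜 n N}

include hq in
theorem qEps_x₁_E₁ (t : ℝ) (hv : v ∈ stateSpace 𝕜 hn N m) :
    qEps 𝕜 N q t (x₁ hn) (E₁ 𝕜 hn N q v) =
      ((q ^ (-t) : ℝ) : 𝕜) • E₁ 𝕜 hn N q (qEps 𝕜 N q t (x₁ hn) v) := by
  rw [qEps_x₁ hn hq t hv, qEps_x₁ hn hq t (E₁_mem hn hq hv), map_smul, smul_smul,
    ← RCLike.ofReal_mul, ← Real.rpow_add hq]
  congr 3
  push_cast
  ring

include hq in
theorem qEps_x₂_E₁ (t : ℝ) (hv : v ∈ stateSpace 𝕜 hn N m) :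
    qEps 𝕜 N q t (x₂ hn) (E₁ 𝕜 hn N q v) =
      ((q ^ t : ℝ) : 𝕜) • E₁ 𝕜 hn N q (qEps 𝕜 N q t (x₂ hn) v) := by
  rw [qEps_x₂ hn hq t hv, qEps_x₂ hn hq t (E₁_mem hn hq hv), map_smul, smul_smul,
    ← RCLike.ofReal_mul, ← Real.rpow_add hq]
  congr 3
  push_cast
  ring

include hq in
theorem qEps_x₁_F₁ (t : ℝ) (hv : v ∈ stateSpace 𝕜 hn N m) :
    qEps 𝕜 N q t (x₁ hn) (F₁ 𝕜 hn N q v) =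
      ((q ^ t : ℝ) : 𝕜) • F₁ 𝕜 hn N q (qEps 𝕜 N q t (x₁ hn) v) := by
  rw [qEps_x₁ hn hq t hv, map_smul]
  -- On $W_0$ both sides vanish; for the other sectors `m - 1` is a genuine predecessor.
  cases m with
  | zero => rw [F₁_eq_zero hn hq hv, map_zero, smul_zero, smul_zero]
  | succ m =>
    rw [qEps_x₁ hn hq t (F₁_mem hn hq hv), smul_smul, ← RCLike.ofReal_mul, ← Real.rpow_add hq,
      Nat.add_sub_cancel]
    congr 3
    push_cast
    ring

include hq in
theorem qEps_x₂_F₁ (t : ℝ) (hv : v ∈ stateSpace 𝕜 hn N m) :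
    qEps 𝕜 N q t (x₂ hn) (F₁ 𝕜 hn N q v) =
      ((q ^ (-t) : ℝ) : 𝕜) • F₁ 𝕜 hn N q (qEps 𝕜 N q t (x₂ hn) v) := by
  rw [qEps_x₂ hn hq t hv, map_smul]
  cases m with
  | zero => rw [F₁_eq_zero hn hq hv, map_zero, smul_zero, smul_zero]
  | succ m =>
    rw [qEps_x₂ hn hq t (F₁_mem hn hq hv), smul_smul, ← RCLike.ofReal_mul, ← Real.rpow_add hq,
      Nat.add_sub_cancel]
    congr 3
    push_cast
    ring

/-- The letter that belongs to `ε_i`. -/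
def letter (i : Fin 2) : Fin n := if i = 0 then x₁ hn else x₂ hn

/-- The action of the generators of `U_q(gl_2)` on `(𝕜^n)^{⊗N}`. -/
noncomputable def uqGenOp (𝕜 : Type*) [RCLike 𝕜] (N : ℕ) (q : ℝ) :
    UqGen → Module.End 𝕜 (TensorSpace 𝕜 n N)
  | .e => E₁ 𝕜 hn N q
  | .f => F₁ 𝕜 hn N q
  | .kPos i => qEps 𝕜 N q (1 / 2) (letter hn i)
  | .kNeg i => qEps 𝕜 N q (-(1 / 2)) (letter hn i)

variable {V : Submodule 𝕜 (TensorSpace 𝕜 n N)}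

/-- A subspace that is spanned by vectors with a fixed number of letters `x_2`. -/
def IsHomogeneous (V : Submodule 𝕜 (TensorSpace 𝕜 n N)) : Prop :=
  ∀ U : Submodule 𝕜 (TensorSpace 𝕜 n N),
    (∀ m, ∀ v ∈ V, v ∈ stateSpace 𝕜 hn N m → v ∈ U) → V ≤ U

variable {hn}

/-- Reduces the relations of $U_q(\mathfrak{gl}_2)$ to vectors in a single sector, where the Cartan
generators act by scalars. -/
theorem IsHomogeneous.ext (hV : IsHomogeneous hn V) {A B : Module.End 𝕜 V}
    (h : ∀ m, ∀ v : V, (v : TensorSpace 𝕜 n N) ∈ stateSpace 𝕜 hn N m →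
      (A v : TensorSpace 𝕜 n N) = B v) : A = B := by
  have hle : V ≤ (LinearMap.eqLocus A B).map V.subtype :=
    hV _ fun m v hvV hv => ⟨⟨v, hvV⟩, Subtype.ext (h m ⟨v, hvV⟩ hv), rfl⟩
  ext1 v
  obtain ⟨u, hu, huv⟩ := hle v.2
  rw [← Subtype.ext huv]
  exact hu

include hq in
theorem IsHomogeneous.qEps_mem (hV : IsHomogeneous hn V) (t : ℝ) (i : Fin 2) (hv : v ∈ V) :
    qEps 𝕜 N q t (letter hn i) v ∈ V := by
  refine hV (V.comap (qEps 𝕜 N q t (letter hn i))) (fun m u huV hu => ?_) hv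
  rw [Submodule.mem_comap]
  fin_cases i
  · exact (qEps_x₁ hn hq t hu) ▸ V.smul_mem _ huV
  · exact (qEps_x₂ hn hq t hu) ▸ V.smul_mem _ huV

include hq in
theorem exists_restrictedAction (hq1 : q ≠ 1) (hV : IsHomogeneous hn V)
    (hE : ∀ v ∈ V, E₁ 𝕜 hn N q v ∈ V) (hF : ∀ v ∈ V, F₁ 𝕜 hn N q v ∈ V) :
    ∃ ρ : UqGl₂ 𝕜 q →ₐ[𝕜] Module.End 𝕜 V, IsRestrictedAction hn ρ := by
  have hmem : ∀ g, ∀ v ∈ V, uqGenOp hn 𝕜 N q g v ∈ V := by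
    rintro (_ | _ | i | i) v hv
    · exact hE v hv
    · exact hF v hv
    · exact hV.qEps_mem hq _ i hv
    · exact hV.qEps_mem hq _ i hv
  let A : UqGen → Module.End 𝕜 V := fun g => (uqGenOp hn 𝕜 N q g).restrict (hmem g)
  have he : ∀ v : V, (A .e v : TensorSpace 𝕜 n N) = E₁ 𝕜 hn N q v := fun _ => rfl
  have hf : ∀ v : V, (A .f v : TensorSpace 𝕜 n N) = F₁ 𝕜 hn N q v := fun _ => rfl
  have hp0 : ∀ v : V, (A (.kPos 0) v : TensorSpace 𝕜 n N) = qEps 𝕜 N q (1 / 2) (x₁ hn) v :=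
    fun _ => rfl
  have hp1 : ∀ v : V, (A (.kPos 1) v : TensorSpace 𝕜 n N) = qEps 𝕜 N q (1 / 2) (x₂ hn) v :=
    fun _ => rfl
  have hn0 : ∀ v : V, (A (.kNeg 0) v : TensorSpace 𝕜 n N) = qEps 𝕜 N q (-(1 / 2)) (x₁ hn) v :=
    fun _ => rfl
  have hn1 : ∀ v : V, (A (.kNeg 1) v : TensorSpace 𝕜 n N) = qEps 𝕜 N q (-(1 / 2)) (x₂ hn) v :=
    fun _ => rfl
  have hrel : ∀ ⦃x y⦄, UqRel 𝕜 q x y → FreeAlgebra.lift 𝕜 A x = FreeAlgebra.lift 𝕜 A y := by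
    intro x y hxy
    apply hV.ext
    intro m v hv
    have k1 := qEps_x₁ hn hq (1 / 2) hv
    have k2 := qEps_x₂ hn hq (1 / 2) hv
    have k1' := qEps_x₁ hn hq (-(1 / 2)) hv
    have k2' := qEps_x₂ hn hq (-(1 / 2)) hv
    have hc : ∀ s t : ℝ, s + t = 0 → ((q ^ s : ℝ) : 𝕜) * ((q ^ t : ℝ) : 𝕜) = 1 := by
      intro s t h
      rw [← RCLike.ofReal_mul, ← Real.rpow_add hq, h, Real.rpow_zero, RCLike.ofReal_one]
    cases hxy with
    | pos_neg i =>
      simp only [map_mul, FreeAlgebra.lift_ι_apply, Module.End.mul_apply, map_one,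
        Module.End.one_apply]
      fin_cases i
      · simp only [Fin.zero_eta, hp0, hn0, k1', map_smul, k1, smul_smul]
        rw [hc _ _ (by ring), one_smul]
      · simp only [Fin.mk_one, hp1, hn1, k2', map_smul, k2, smul_smul]
        rw [hc _ _ (by ring), one_smul]
    | neg_pos i =>
      simp only [map_mul, FreeAlgebra.lift_ι_apply, Module.End.mul_apply, map_one,
        Module.End.one_apply]
      fin_cases i
      · simp only [Fin.zero_eta, hp0, hn0, k1', map_smul, k1, smul_smul]
        rw [hc _ _ (by ring), one_smul]
      · simp only [Fin.mk_one, hp1, hn1, k2', map_smul, k2, smul_smul]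
        rw [hc _ _ (by ring), one_smul]
    | comm =>
      simp only [map_mul, FreeAlgebra.lift_ι_apply, Module.End.mul_apply, hp0, hp1, k1, k2,
        map_smul, smul_smul]
      rw [mul_comm]
    | k_f₁ =>
      simp only [map_mul, map_smul, FreeAlgebra.lift_ι_apply, Module.End.mul_apply,
        LinearMap.smul_apply, Submodule.coe_smul, hp0, hf]
      exact qEps_x₁_F₁ hn hq _ hv
    | k_f₂ =>
      simp only [map_mul, map_smul, FreeAlgebra.lift_ι_apply, Module.End.mul_apply,
        LinearMap.smul_apply, Submodule.coe_smul, hp1, hf]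
      exact qEps_x₂_F₁ hn hq _ hv
    | k_e₁ =>
      simp only [map_mul, map_smul, FreeAlgebra.lift_ι_apply, Module.End.mul_apply,
        LinearMap.smul_apply, Submodule.coe_smul, hp0, he]
      exact qEps_x₁_E₁ hn hq _ hv
    | k_e₂ =>
      simp only [map_mul, map_smul, FreeAlgebra.lift_ι_apply, Module.End.mul_apply,
        LinearMap.smul_apply, Submodule.coe_smul, hp1, he]
      exact qEps_x₂_E₁ hn hq _ hv
    | f_e =>
      have h := F₁_E₁_sub hn hq hv
      simp only [freeQHalfH, freeQHalfHInv, map_sub, map_mul, map_smul, pow_two,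
        FreeAlgebra.lift_ι_apply, Module.End.mul_apply, LinearMap.sub_apply, Submodule.coe_sub,
        LinearMap.smul_apply, Submodule.coe_smul, hp0, hp1, hn0, hn1, he, hf, k1, k2, k1', k2']
      rw [h, smul_smul, smul_smul, smul_smul, smul_smul, smul_smul, smul_smul, ← sub_smul,
        smul_smul]
      congr 1
      simp only [← RCLike.ofReal_mul, ← RCLike.ofReal_sub, ← Real.rpow_add hq]
      -- $q^{\pm h/2}$ acts as $q^{\pm(N-2m)/2}$, so the squares give the numerator of $[N-2m]_q$;
      -- for $q\ne1$ the quotient formula applies.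
      rw [qNum, if_neg hq1, div_eq_inv_mul]
      congr 4 <;> ring
  refine ⟨RingQuot.liftAlgHom 𝕜 ⟨FreeAlgebra.lift 𝕜 A, hrel⟩, fun v => ?_⟩
  have hgen : ∀ g, RingQuot.liftAlgHom 𝕜 ⟨FreeAlgebra.lift 𝕜 A, hrel⟩ (UqGl₂.gen 𝕜 q g) = A g := by
    intro g
    rw [UqGl₂.gen, RingQuot.liftAlgHom_mkAlgHom_apply, FreeAlgebra.lift_ι_apply]
  simp only [hgen]
  exact ⟨rfl, rfl, rfl, rfl, rfl, rfl⟩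

include hq in
theorem IsRestrictedAction.qh_apply {ρ : UqGl₂ 𝕜 q →ₐ[𝕜] Module.End 𝕜 V}
    (hρ : IsRestrictedAction hn ρ) (v : V) (hv : (v : TensorSpace 𝕜 n N) ∈ stateSpace 𝕜 hn N m) :
    ρ (UqGl₂.qh 𝕜 q) v = ((q ^ ((N : ℤ) - 2 * (m : ℤ)) : ℝ) : 𝕜) • v := by
  have hk : ρ (UqGl₂.gen 𝕜 q (UqGen.kPos 0) * UqGl₂.gen 𝕜 q (UqGen.kNeg 1)) v =
      ((q ^ ((N - 2 * m : ℝ) / 2) : ℝ) : 𝕜) • v := by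
    apply Subtype.ext
    have h1 : ρ (UqGl₂.gen 𝕜 q (UqGen.kNeg 1)) v = ((q ^ (-(1 / 2) * m : ℝ) : ℝ) : 𝕜) • v :=
      Subtype.ext ((hρ v).2.2.2.2.2.trans (qEps_x₂ hn hq _ hv))
    have h2 := (hρ v).2.2.1
    rw [qEps_x₁ hn hq _ hv] at h2
    rw [map_mul, Module.End.mul_apply, h1, map_smul,
      Submodule.coe_smul, h2, smul_smul, ← RCLike.ofReal_mul, ← Real.rpow_add hq,
      Submodule.coe_smul]
    congr 3
    ring
  rw [UqGl₂.qh, pow_two, map_mul, Module.End.mul_apply, hk, map_smul, hk, smul_smul,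
    ← RCLike.ofReal_mul, ← Real.rpow_add hq, add_halves, ← Real.rpow_intCast]
  push_cast
  rfl

end QuantumAlgebra

/-! ### Counting the eigenvalues of a sector -/

section Counting

variable {𝕜 : Type*} [RCLike 𝕜] {n N k : ℕ} {hn : 2 ≤ n} {q : ℝ}

theorem linearIndependent_of_eigenvalues {s : Set ℝ} {x : s → TensorSpace 𝕜 n N}
    (h0 : ∀ Λ, x Λ ≠ 0) (h : ∀ Λ : s, hamiltonian 𝕜 n N q (x Λ) = ((Λ : ℝ) : 𝕜) • x Λ) :
    LinearIndependent 𝕜 x :=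
  Module.End.eigenvectors_linearIndependent' (hamiltonian 𝕜 n N q) (fun Λ : s => ((Λ : ℝ) : 𝕜))
    (fun _ _ hΛ => Subtype.ext (RCLike.ofReal_injective hΛ)) x
    fun Λ => ⟨Module.End.mem_eigenspace_iff.2 (h Λ), h0 Λ⟩

theorem ncard_le_finrank {s : Set ℝ} (hs : s.Finite) {U : Submodule 𝕜 (TensorSpace 𝕜 n N)}
    (h : ∀ Λ ∈ s, ∃ b ∈ U, b ≠ 0 ∧ hamiltonian 𝕜 n N q b = (Λ : 𝕜) • b) :
    s.ncard ≤ Module.finrank 𝕜 U := by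
  choose! x hxU hx0 hx using h
  have := hs.fintype
  have hli : LinearIndependent 𝕜 (fun Λ : s => (⟨x Λ, hxU Λ Λ.2⟩ : U)) :=
    LinearIndependent.of_comp U.subtype
      (linearIndependent_of_eigenvalues (q := q) (x := fun Λ : s => x Λ) (fun Λ => hx0 Λ Λ.2)
        fun Λ => hx Λ Λ.2)
  rw [Set.ncard_eq_toFinset_card', Set.toFinset_card]
  exact hli.fintype_card_le_finrank

/-- $\ker F_1$ and the image of $E_1$ meet trivially inside $W_{m+1}$, by adjointness, and the image
has full dimension $\binom Nm$, by injectivity. -/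
theorem finrank_ker_add_le (hq : 0 < q) {m : ℕ} (hm : 2 * m < N) :
    Module.finrank 𝕜 (LinearMap.ker (F₁ 𝕜 hn N q) ⊓ stateSpace 𝕜 hn N (m + 1) :
      Submodule 𝕜 (TensorSpace 𝕜 n N)) + N.choose m ≤ N.choose (m + 1) := by
  set U := LinearMap.ker (F₁ 𝕜 hn N q) ⊓ stateSpace 𝕜 hn N (m + 1)
  set E' := (E₁ 𝕜 hn N q).domRestrict (stateSpace 𝕜 hn N m)
  have hinj : Function.Injective E' := by
    rw [injective_iff_map_eq_zero]
    exact fun v hv => Subtype.ext (E₁_injOn hn hq hm v.2 hv)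
  have hdis : U ⊓ LinearMap.range E' = ⊥ := by
    rw [Submodule.eq_bot_iff]
    rintro _ ⟨⟨hF, -⟩, u, rfl⟩
    have hF' : F₁ 𝕜 hn N q (E₁ 𝕜 hn N q u) = 0 := hF
    have : E₁ 𝕜 hn N q u = 0 := by
      rw [← inner_self_eq_zero (𝕜 := 𝕜), inner_E₁, hF', inner_zero_right]
    exact this
  have hsup : U ⊔ LinearMap.range E' ≤ stateSpace 𝕜 hn N (m + 1) := by
    refine sup_le inf_le_right ?_
    rintro _ ⟨u, rfl⟩
    exact E₁_mem hn hq u.2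
  have h1 := Submodule.finrank_sup_add_finrank_inf_eq U (LinearMap.range E')
  rw [hdis, finrank_bot, add_zero, LinearMap.finrank_range_of_inj hinj, finrank_stateSpace] at h1
  rw [← h1, ← finrank_stateSpace (𝕜 := 𝕜) (n := n) hn]
  exact Submodule.finrank_mono hsup

theorem sectorEigenvalues_subset :
    sectorEigenvalues 𝕜 hn N k q ⊆ eigenvalues 𝕜 hn N k q := fun _ ⟨b, hb, _⟩ => ⟨b, hb⟩

/-- An infinite set has `ncard` zero, whereas the binomial coefficient is positive. -/
theorem finite_eigenvalues (hk : 2 * k ≤ N)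
    (hd : (eigenvalues 𝕜 hn N k q).ncard = N.choose k) : (eigenvalues 𝕜 hn N k q).Finite :=
  Set.finite_of_ncard_pos (hd ▸ Nat.choose_pos (by omega))

theorem sectorEigenvalues_zero (hq : 0 < q) :
    sectorEigenvalues 𝕜 hn N 0 q = eigenvalues 𝕜 hn N 0 q :=
  sectorEigenvalues_subset.antisymm fun _ ⟨b, hb⟩ => ⟨b, hb, F₁_eq_zero hn hq hb.1⟩

theorem ncard_sectorEigenvalues_succ (hq : 0 < q) (hk : 2 * (k + 1) ≤ N)
    (hd : (eigenvalues 𝕜 hn N (k + 1) q).ncard = N.choose (k + 1)) :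
    (sectorEigenvalues 𝕜 hn N (k + 1) q).ncard + N.choose k = N.choose (k + 1) := by
  have hfin := finite_eigenvalues hk hd
  have h1 : (sectorEigenvalues 𝕜 hn N (k + 1) q).ncard ≤
      Module.finrank 𝕜 (LinearMap.ker (F₁ 𝕜 hn N q) ⊓ stateSpace 𝕜 hn N (k + 1) :
        Submodule 𝕜 (TensorSpace 𝕜 n N)) :=
    ncard_le_finrank (q := q) (hfin.subset sectorEigenvalues_subset)
      fun Λ ⟨b, hb, hF⟩ => ⟨b, ⟨hF, hb.1⟩, hb.2⟩
  -- Outside the sector $F_1b\ne0$, and it is an eigenvector one level lower for the same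
  -- eigenvalue. This and the kernel bound exhaust $\binom N{k+1}$, so both are sharp.
  have h2 : (eigenvalues 𝕜 hn N (k + 1) q \ sectorEigenvalues 𝕜 hn N (k + 1) q).ncard ≤
      N.choose k := by
    rw [← finrank_stateSpace (𝕜 := 𝕜) (n := n) hn]
    refine ncard_le_finrank (q := q) hfin.sdiff ?_
    rintro Λ ⟨⟨b, hb⟩, hΛ⟩
    have hFb : F₁ 𝕜 hn N q b ∈ stateSpace 𝕜 hn N (k + 1 - 1) := F₁_mem hn hq hb.1
    rw [Nat.add_sub_cancel] at hFb
    refine ⟨F₁ 𝕜 hn N q b, hFb, fun h => hΛ ⟨b, hb, h⟩, ?_⟩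
    rw [hamiltonian_F₁ hn hq hb.1, hb.2.2, map_smul]
  have h3 := finrank_ker_add_le (𝕜 := 𝕜) (hn := hn) hq (m := k) (N := N) (by omega)
  have h4 := Set.ncard_sdiff_add_ncard_of_subset
    (sectorEigenvalues_subset (𝕜 := 𝕜) (hn := hn) (N := N) (k := k + 1) (q := q)) hfin
  omega

theorem ncard_sectorEigenvalues_int (hq : 0 < q) (hk : 2 * k ≤ N)
    (hd : (eigenvalues 𝕜 hn N k q).ncard = N.choose k) :
    ((sectorEigenvalues 𝕜 hn N k q).ncard : ℤ) =
      (N.choose k : ℤ) - (if k = 0 then 0 else (N.choose (k - 1) : ℤ)) := by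
  cases k with
  | zero => rw [sectorEigenvalues_zero hq, hd, if_pos rfl, sub_zero]
  | succ k =>
    rw [if_neg k.succ_ne_zero, Nat.add_sub_cancel, ← ncard_sectorEigenvalues_succ hq hk hd]
    push_cast
    ring

theorem choose_sub_choose_pred (hk : 2 * k ≤ N) :
    (N.choose k : ℚ) - (if k = 0 then 0 else (N.choose (k - 1) : ℚ)) =
      (N.factorial : ℚ) / ((k.factorial : ℚ) * ((N - k + 1).factorial : ℚ)) *
        ((N : ℚ) - 2 * k + 1) := by
  have hf : ∀ m : ℕ, (m.factorial : ℚ) ≠ 0 := fun m => by exact_mod_cast m.factorial_ne_zero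
  obtain ⟨M, rfl⟩ : ∃ M, N = k + M := ⟨N - k, by omega⟩
  have hM : (M + 1 : ℚ) ≠ 0 := by positivity
  have h1 := hf M
  rw [Nat.add_sub_cancel_left, Nat.factorial_succ]
  cases k with
  | zero =>
    have h0 := hf 0
    simp only [if_true, Nat.choose_zero_right, zero_add, Nat.factorial_zero]
    push_cast
    field_simp
    ring
  | succ k =>
    have h2 := hf k
    have hk1 : (k + 1 : ℚ) ≠ 0 := by positivity
    rw [if_neg k.succ_ne_zero, Nat.add_sub_cancel, Nat.cast_choose ℚ (by omega),
      Nat.cast_choose ℚ (by omega), Nat.add_sub_cancel_left,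
      show k + 1 + M - k = M + 1 by omega, Nat.factorial_succ k, Nat.factorial_succ M]
    push_cast
    field_simp
    ring

/-- There are as many eigenvalues as dimensions, so eigenvectors form a basis of $W_k$ and each
eigenspace there is a line. -/
theorem F₁_eq_zero_of_mem_sectorEigenvalues (hk : 2 * k ≤ N)
    (hd : (eigenvalues 𝕜 hn N k q).ncard = N.choose k) {Λ : ℝ}
    (hΛ : Λ ∈ sectorEigenvalues 𝕜 hn N k q) {b : TensorSpace 𝕜 n N} (hb : IsEigenstate hn k q Λ b) :
    F₁ 𝕜 hn N q b = 0 := by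
  obtain ⟨b', hb', hF⟩ := hΛ
  have := (finite_eigenvalues hk hd).fintype
  -- The eigenbasis is chosen to contain the given `b'` at `Λ`.
  have hex : ∀ μ : eigenvalues 𝕜 hn N k q, ∃ x : TensorSpace 𝕜 n N, IsEigenstate hn k q μ x ∧
      (μ = Λ → x = b') := by
    rintro ⟨μ, x, hx⟩
    by_cases h : μ = Λ
    · exact ⟨b', by subst h; exact hb', fun _ => rfl⟩
    · exact ⟨x, hx, fun h' => absurd h' h⟩
  choose x hx hxΛ using hex
  have hli : LinearIndependent 𝕜 x :=
    linearIndependent_of_eigenvalues (q := q) (fun μ => (hx μ).2.1) fun μ => (hx μ).2.2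
  have hspan : Submodule.span 𝕜 (Set.range x) = stateSpace 𝕜 hn N k := by
    refine Submodule.eq_of_le_of_finrank_eq ?_ ?_
    · rw [Submodule.span_le]
      rintro _ ⟨μ, rfl⟩
      exact (hx μ).1
    · rw [finrank_span_eq_card hli, finrank_stateSpace, ← hd, Set.ncard_eq_toFinset_card',
        Set.toFinset_card]
  have hbs := hb.1
  rw [← hspan, Submodule.mem_span_range_iff_exists_fun] at hbs
  obtain ⟨c, hc⟩ := hbs
  -- Apply $\mathcal H-\Lambda$ to the expansion of $b$: only the coefficient at `Λ` can survive.
  have hz : ∑ μ, (c μ * (((μ : ℝ) : 𝕜) - (Λ : 𝕜))) • x μ = 0 := by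
    have h1 := hb.2.2
    rw [← hc, map_sum, Finset.smul_sum, ← sub_eq_zero, ← Finset.sum_sub_distrib] at h1
    rw [← h1]
    refine Finset.sum_congr rfl fun μ _ => ?_
    rw [map_smul, (hx μ).2.2]
    module
  have hcz := Fintype.linearIndependent_iff.1 hli _ hz
  rw [← hc, map_sum]
  refine Finset.sum_eq_zero fun μ _ => ?_
  rw [map_smul]
  by_cases h : (μ : ℝ) = Λ
  · rw [hxΛ μ h, hF, smul_zero]
  · have h2 := hcz μ
    rw [mul_eq_zero, sub_eq_zero] at h2
    rcases h2 with h2 | h2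
    · rw [h2, zero_smul]
    · exact absurd (RCLike.ofReal_injective h2) h

end Counting

/-! ### The orbit as an irreducible module -/

section Module

variable {𝕜 : Type*} [RCLike 𝕜] {n N k : ℕ} {hn : 2 ≤ n} {q : ℝ} {b : TensorSpace 𝕜 n N}

theorem isHomogeneous_orbitSpan (hq : 0 < q) (hk : 2 * k ≤ N) (hb : b ∈ stateSpace 𝕜 hn N k) :
    IsHomogeneous hn (orbitSpan hn k q b) := fun _ h =>
  orbitSpan_le hn hk fun i hi =>
    h (k + i) _ (orbitVec_mem_orbitSpan hn hi) (orbitVec_mem hn hq hb i)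

/-- Naming $r=N-2k-i$ by an additive equation lets one lemma serve the differently truncated
subtractions in the theorem and in `IsCanonicalBasis`. -/
theorem F₁_orbitVec_succ_qInt (hq : 0 < q) (hb : b ∈ stateSpace 𝕜 hn N k)
    (hF : F₁ 𝕜 hn N q b = 0) {i r : ℕ} (hi : 2 * k + i + r = N) :
    F₁ 𝕜 hn N q (orbitVec hn k q b (k + (i + 1))) =
      ((qInt q (i + 1) * qInt q r : ℝ) : 𝕜) • orbitVec hn k q b (k + i) := by
  have hr : (r : ℝ) = N - 2 * k - i := by rw [← hi]; push_cast; ring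
  rw [F₁_orbitVec_succ hn hq hb hF, qInt_eq_qNum, qInt_eq_qNum, hr, Nat.cast_add_one]

theorem isIrreducibleRep_orbitSpan (hq : 0 < q) (hk : 2 * k ≤ N) (hb : b ∈ stateSpace 𝕜 hn N k)
    (hF : F₁ 𝕜 hn N q b = 0) (hb0 : b ≠ 0)
    {ρ : UqGl₂ 𝕜 q →ₐ[𝕜] Module.End 𝕜 (orbitSpan hn k q b)} (hρ : IsRestrictedAction hn ρ) :
    IsIrreducibleRep ρ := by
  constructor
  · have hbV : b ∈ orbitSpan hn k q b := by
      simpa [orbitVec_zero] using orbitVec_mem_orbitSpan hn (q := q) (b := b) (i := 0) hk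
    exact ⟨⟨b, hbV⟩, 0, fun h => hb0 (congrArg Subtype.val h)⟩
  · intro W hW
    -- The generators $e$ and $f$ alone force irreducibility, so the image of `W` in the ambient
    -- space only has to be invariant under $E_1$ and $F_1$.
    have h := eq_bot_or_eq_orbitSpan hn hq hk hb hF hb0
      (W := W.map (orbitSpan hn k q b).subtype) (Submodule.map_subtype_le _ _) (by
        rintro _ ⟨w, hw, rfl⟩
        exact ⟨⟨_, hW _ w hw, (hρ w).1⟩, ⟨_, hW _ w hw, (hρ w).2.1⟩⟩)
    have hinj := Submodule.map_injective_of_injective (orbitSpan hn k q b).injective_subtype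
    refine h.imp (fun h => hinj ?_) fun h => hinj ?_
    · rw [h, Submodule.map_bot]
    · rw [h, Submodule.map_subtype_top]

theorem isCanonicalBasis_orbitSpan (hq : 0 < q) (hk : 2 * k ≤ N) (hb : b ∈ stateSpace 𝕜 hn N k)
    (hF : F₁ 𝕜 hn N q b = 0) {ρ : UqGl₂ 𝕜 q →ₐ[𝕜] Module.End 𝕜 (orbitSpan hn k q b)}
    (hρ : IsRestrictedAction hn ρ) {β : Module.Basis (Fin (N - 2 * k + 1)) 𝕜 (orbitSpan hn k q b)}
    (hβ : ∀ i, (β i : TensorSpace 𝕜 n N) = orbitVec hn k q b (k + i.1)) :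
    IsCanonicalBasis ρ β := by
  refine ⟨fun i hi => Subtype.ext ?_, fun i hi => Subtype.ext ?_, fun i j hij => Subtype.ext ?_,
    fun i j hij => Subtype.ext ?_, fun i => ?_⟩
  · rw [(hρ _).2.1, hβ, hi, add_zero, orbitVec_zero, hF, Submodule.coe_zero]
  · rw [(hρ _).1, hβ, E₁_orbitVec_top hn hq hb hF (by omega), Submodule.coe_zero]
  · rw [(hρ _).1, hβ, hβ, hij, orbitVec_succ]
  · rw [(hρ _).2.1, hβ, Submodule.coe_smul, hβ, hij]
    exact F₁_orbitVec_succ_qInt hq hb hF (by omega)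
  · rw [hρ.qh_apply hq (m := k + i.1) _ (by rw [hβ]; exact orbitVec_mem hn hq hb _)]
    congr 3
    omega

end Module

end SpinChain

theorem theorem7p1 (𝕜 : Type*) [RCLike 𝕜] (n N k : ℕ) (hn : 2 ≤ n) (hk : 2 * k ≤ N)
    (q : ℝ) (hq : 0 < q)
    -- the eigenvalue problem, of size `binom(N, k)`, has distinct eigenvalues
    (hdistinct : (SpinChain.eigenvalues 𝕜 hn N k q).ncard = N.choose k) :
    -- (1) the number of eigenvalues in the `k`-sector, in both forms
    (((SpinChain.sectorEigenvalues 𝕜 hn N k q).ncard : ℤ)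
        = (N.choose k : ℤ) - (if k = 0 then 0 else (N.choose (k - 1) : ℤ))) ∧
    (((SpinChain.sectorEigenvalues 𝕜 hn N k q).ncard : ℚ)
        = (N.factorial : ℚ) / ((k.factorial : ℚ) * ((N - k + 1).factorial : ℚ))
            * ((N : ℚ) - 2 * k + 1)) ∧
    -- the eigenstates of these eigenvalues are highest-weight vectors
    (∀ Λ ∈ SpinChain.sectorEigenvalues 𝕜 hn N k q, ∀ b : SpinChain.TensorSpace 𝕜 n N,
        SpinChain.IsEigenstate hn k q Λ b → SpinChain.F₁ 𝕜 hn N q b = 0) ∧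
    -- the orbit of each such eigenstate `b`
    (∀ (Λ : ℝ) (b : SpinChain.TensorSpace 𝕜 n N),
        SpinChain.IsEigenstate hn k q Λ b → SpinChain.F₁ 𝕜 hn N q b = 0 →
      -- (2)
      (∀ m, k ≤ m → m + 1 ≤ N - k →
        SpinChain.F₁ 𝕜 hn N q (SpinChain.orbitVec hn k q b (m + 1))
          = ((SpinChain.qInt q (N - k - m) * SpinChain.qInt q (m - k + 1) : ℝ) : 𝕜) •
              SpinChain.orbitVec hn k q b m) ∧
      SpinChain.E₁ 𝕜 hn N q (SpinChain.orbitVec hn k q b (N - k)) = 0 ∧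
      (∀ m, k ≤ m → m ≤ N - k →
        SpinChain.qH₁ 𝕜 hn N q (SpinChain.orbitVec hn k q b m)
          = ((q ^ ((N : ℤ) - 2 * (m : ℤ)) : ℝ) : 𝕜) • SpinChain.orbitVec hn k q b m) ∧
      -- (3) the orbit consists of pairwise orthogonal eigenstates with the same eigenvalue
      (∀ m, k ≤ m → m ≤ N - k →
        SpinChain.IsEigenstate hn m q Λ (SpinChain.orbitVec hn k q b m)) ∧
      (∀ m m', k ≤ m → m ≤ N - k → k ≤ m' → m' ≤ N - k → m ≠ m' →
        inner 𝕜 (SpinChain.orbitVec hn k q b m) (SpinChain.orbitVec hn k q b m') = 0) ∧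
      -- it is a basis of an `(N - 2k + 1)`-dimensional space `V`
      ∃ β : Module.Basis (Fin (N - 2 * k + 1)) 𝕜 (SpinChain.orbitSpan hn k q b),
        (∀ i, (β i : SpinChain.TensorSpace 𝕜 n N) = SpinChain.orbitVec hn k q b (k + i.1)) ∧
        -- `V` is invariant under `E_1` and `F_1`, and irreducible under them
        (∀ v ∈ SpinChain.orbitSpan hn k q b,
          SpinChain.E₁ 𝕜 hn N q v ∈ SpinChain.orbitSpan hn k q b ∧
          SpinChain.F₁ 𝕜 hn N q v ∈ SpinChain.orbitSpan hn k q b) ∧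
        (∀ W ≤ SpinChain.orbitSpan hn k q b,
          (∀ w ∈ W, SpinChain.E₁ 𝕜 hn N q w ∈ W ∧ SpinChain.F₁ 𝕜 hn N q w ∈ W) →
          W = ⊥ ∨ W = SpinChain.orbitSpan hn k q b) ∧
        -- for `q ≠ 1`, `V` is an irreducible `U_q(gl_2)`-module with canonical basis `β`
        (q ≠ 1 → ∃ ρ : SpinChain.UqGl₂ 𝕜 q →ₐ[𝕜]
            Module.End 𝕜 (SpinChain.orbitSpan hn k q b),
          SpinChain.IsRestrictedAction hn ρ ∧ SpinChain.IsIrreducibleRep ρ ∧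
            SpinChain.IsCanonicalBasis ρ β)) := by
  refine ⟨SpinChain.ncard_sectorEigenvalues_int hq hk hdistinct, ?_,
    fun Λ hΛ b hb => SpinChain.F₁_eq_zero_of_mem_sectorEigenvalues hk hdistinct hΛ hb, ?_⟩
  · rw [← SpinChain.choose_sub_choose_pred hk]
    have h := congrArg (Int.cast : ℤ → ℚ)
      (SpinChain.ncard_sectorEigenvalues_int hq hk hdistinct)
    push_cast at h
    exact h
  · rintro Λ b ⟨hb, hb0, hΛ⟩ hF
    refine ⟨?_, ?_, ?_, ?_, ?_, ?_⟩
    · intro m hkm hm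
      obtain ⟨i, rfl⟩ := Nat.exists_eq_add_of_le hkm
      rw [mul_comm, Nat.add_sub_cancel_left]
      exact SpinChain.F₁_orbitVec_succ_qInt hq hb hF (by omega)
    · have h := SpinChain.E₁_orbitVec_top hn hq hb hF (i := N - 2 * k) (by omega)
      rwa [show k + (N - 2 * k) = N - k by omega] at h
    · intro m hkm _
      obtain ⟨i, rfl⟩ := Nat.exists_eq_add_of_le hkm
      exact SpinChain.qH₁_apply hn hq (SpinChain.orbitVec_mem hn hq hb i)
    · intro m hkm hm
      obtain ⟨i, rfl⟩ := Nat.exists_eq_add_of_le hkm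
      exact ⟨SpinChain.orbitVec_mem hn hq hb i,
        SpinChain.orbitVec_ne_zero hn hq hb hF hb0 (by omega),
        SpinChain.hamiltonian_orbitVec hn hq hb hΛ i⟩
    · intro m m' hkm _ hkm' _ hne
      obtain ⟨i, rfl⟩ := Nat.exists_eq_add_of_le hkm
      obtain ⟨j, rfl⟩ := Nat.exists_eq_add_of_le hkm'
      exact SpinChain.inner_orbitVec hn hq hb (by omega)
    · obtain ⟨β, hβ⟩ := SpinChain.exists_basis_orbitSpan hn hq hk hb hF hb0
      refine ⟨β, hβ, fun v hv => ⟨SpinChain.E₁_mem_orbitSpan hn hq hk hb hF hv,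
        SpinChain.F₁_mem_orbitSpan hn hq hk hb hF hv⟩,
        fun W hWV hW => SpinChain.eq_bot_or_eq_orbitSpan hn hq hk hb hF hb0 hWV hW,
        fun hq1 => ?_⟩
      obtain ⟨ρ, hρ⟩ := SpinChain.exists_restrictedAction hq hq1
        (SpinChain.isHomogeneous_orbitSpan hq hk hb)
        (fun v hv => SpinChain.E₁_mem_orbitSpan hn hq hk hb hF hv)
        (fun v hv => SpinChain.F₁_mem_orbitSpan hn hq hk hb hF hv)
      exact ⟨ρ, hρ, SpinChain.isIrreducibleRep_orbitSpan hq hk hb hF hb0 hρ,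
        SpinChain.isCanonicalBasis_orbitSpan hq hk hb hF hρ hβ⟩
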